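/- A \emph{$2$-edge coloured graph} is a pair $(G,s)$ where $G$ is a simple graph and $s:E(G)\to\{+,-\}$. A \emph{homomorphism} $(G,s)\to(H,t)$ is a graph homomorphism $\phi:G\to H$ with $t(\phi(u)\phi(v))=s(uv)$ for every edge $uv$ of $G$. A \emph{$k$-colouring} of $(G,s)$ is a homomorphism to some $2$-edge coloured graph with $k$ vertices, and the \emph{chromatic number} $\chi((G,s))$ is the least $k$ for which $(G,s)$ admits a $k$-colouring. Let $SP_9$ be the $2$-edge coloured complete graph on the nine vertices of the Cartesian product $K_3\square K_3$, in which an edge is positive if it is an edge of $K_3\square K_3$ and negative otherwise. \textbf{Theorem.} Let $(G,s)$ be a $2$-edge coloured graph whose underlying graph $G$ is finite, connected and cubic (that is, $3$-regular). Then $\chi((G,s))\le 10$. Moreover, there is a $2$-edge coloured graph $H$ on ten vertices, obtained from $SP_9$ by adding one new vertex together with some signed edges between it and vertices of $SP_9$ (which may depend on $(G,s)$), such that $(G,s)\to H$. -/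

import Mathlib

/-- The two edge colours: positive (`+`) and negative (`-`). -/
inductive EdgeSign : Type
  | pos
  | neg
  deriving DecidableEq

universe u v

/-- A 2-edge coloured graph `(G, s)` on the vertex type `V`: a simple graph together with a map
from its edge set to the two colours. -/
structure TwoEdgeColouredGraph (V : Type u) where
  /-- the underlying simple graph -/
  graph : SimpleGraph V
  /-- the colour of each edge -/
  sign : graph.edgeSet → EdgeSign

namespace TwoEdgeColouredGraph

/-- The colour of the edge joining two adjacent vertices. -/
def edgeSign {V : Type u} (G : TwoEdgeColouredGraph V) {x y : V} (h : G.graph.Adj x y) :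
    EdgeSign :=
  G.sign ⟨s(x, y), h⟩

/-- A homomorphism of 2-edge coloured graphs: a homomorphism of the underlying simple graphs that
preserves the colour of every edge. -/
structure Hom {V : Type u} {W : Type v} (G : TwoEdgeColouredGraph V)
    (H : TwoEdgeColouredGraph W) where
  /-- the homomorphism of underlying graphs -/
  toHom : G.graph →g H.graph
  /-- edge colours are preserved -/
  map_edgeSign : ∀ (x y : V) (h : G.graph.Adj x y),
    G.edgeSign h = H.edgeSign (toHom.map_adj h)

/-- `G` admits a `k`-colouring: a homomorphism to some 2-edge coloured graph with `k` vertices. -/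
def Colourable {V : Type u} (G : TwoEdgeColouredGraph V) (k : ℕ) : Prop :=
  ∃ H : TwoEdgeColouredGraph (Fin k), Nonempty (G.Hom H)

/-- The chromatic number: the least `k` such that `G` admits a `k`-colouring
(`⊤` if there is no such `k`). -/
noncomputable def chromaticNumber {V : Type u} (G : TwoEdgeColouredGraph V) : ℕ∞ :=
  ⨅ k ∈ {k : ℕ | G.Colourable k}, (k : ℕ∞)

open scoped Classical in
/-- The 2-edge coloured complete graph `SP₉` on nine vertices, whose positive edges are those of
`K₃ □ K₃` and whose negative edges are all the others. -/
noncomputable def SP9 : TwoEdgeColouredGraph (Fin 3 × Fin 3) where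
  graph := ⊤
  sign e :=
    if e.1 ∈ ((⊤ : SimpleGraph (Fin 3)).boxProd (⊤ : SimpleGraph (Fin 3))).edgeSet then
      EdgeSign.pos
    else EdgeSign.neg

/-- `H` is formed from `G` by adding one new vertex `none`, together with arbitrary coloured edges
between `none` and vertices of `G`: the restriction of `H` to the old vertices is `G`. -/
def IsOneVertexExtension {V : Type u} (G : TwoEdgeColouredGraph V)
    (H : TwoEdgeColouredGraph (Option V)) : Prop :=
  (∀ x y : V, H.graph.Adj (some x) (some y) ↔ G.graph.Adj x y) ∧
    ∀ (x y : V) (h : G.graph.Adj x y) (h' : H.graph.Adj (some x) (some y)),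
      H.edgeSign h' = G.edgeSign h

end TwoEdgeColouredGraph

/-! `SP₉` is vertex transitive, and each of its edges lies in exactly one monochromatic triangle.
For `x ≠ y` and prescribed signs `a`, `b` some vertex sees `x` with sign `a` and `y` with sign `b`,
and there are at least two such vertices unless `x`, `y` and the vertex form a monochromatic
triangle.

Colour a subcubic 2-degenerate graph greedily: remove a vertex `v` with at most two neighbours. This
fails only if the two neighbours need different signs but always receive one colour. By uniqueness
of triangles, the ends of a monochromatic diamond always do, so a diamond whose ends see a common
vertex with different signs (a rooted diamond) is an obstruction. `Good.exists_isHom` shows that it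
is the only one. Its core is `Good.exists_isHom_ne`: if `u` and `w` always agree, then `u` has no
freedom, so its neighbours `u₁`, `u₂` are forced to complete a monochromatic triangle with it. Local
replacements (`Fork.contract`, `reattach`) give good graphs whose colourings contradict this.

A connected cubic graph becomes 2-degenerate once an edge is lost, and the tenth vertex makes up for
the loss. If there is a rooted diamond, one fixed extension (`diamondSign`) colours all rooted
diamonds. If all edges at some `v` have one sign, `v` goes to the new vertex. Otherwise each vertex
has one minority edge; if some edge is in the majority at both ends, `Split.exists_isHom` applies,
and finiteness supplies such an edge. -/

/-! ### Finite facts about `SP₉` -/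

/-- The sign of a pair of vertices of `SP₉`, with value `0` on the diagonal. -/
def sp9Sign (x y : Fin 3 × Fin 3) : SignType :=
  if x = y then 0 else if x.1 = y.1 ∨ x.2 = y.2 then 1 else -1

theorem sp9Sign_comm (x y : Fin 3 × Fin 3) : sp9Sign x y = sp9Sign y x := by
  revert x y; decide +kernel

@[simp] theorem sp9Sign_self (x : Fin 3 × Fin 3) : sp9Sign x x = 0 := by
  simp [sp9Sign]

theorem sp9Sign_eq_zero {x y : Fin 3 × Fin 3} : sp9Sign x y = 0 ↔ x = y := by
  revert x y; decide +kernel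

theorem sp9Sign_add_right (x y d : Fin 3 × Fin 3) :
    sp9Sign (x + d) (y + d) = sp9Sign x y := by
  revert x y d; decide +kernel

theorem sp9Sign_add_left_eq (x y d : Fin 3 × Fin 3) : sp9Sign (x + d) y = sp9Sign x (y - d) := by
  rw [← sp9Sign_add_right x (y - d) d, sub_add_cancel]

theorem sp9Sign_add_right_eq (x y d : Fin 3 × Fin 3) : sp9Sign x (y + d) = sp9Sign (x - d) y := by
  rw [sp9Sign_comm, sp9Sign_add_left_eq, sp9Sign_comm]

theorem sp9_exists_one (x f : Fin 3 × Fin 3) (a : SignType) (ha : a ≠ 0) :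
    ∃ z, sp9Sign z x = a ∧ z ≠ f := by
  revert x f a; decide +kernel

theorem sp9_exists_two (x y : Fin 3 × Fin 3) (a b : SignType) (ha : a ≠ 0) (hb : b ≠ 0)
    (h : x = y → a = b) : ∃ z, sp9Sign z x = a ∧ sp9Sign z y = b := by
  revert x y a b; decide +kernel

/-- The excluded case is the one where `z` is the unique third vertex of a monochromatic triangle;
in every other case there are at least two choices, so `f` can be avoided. -/
theorem sp9_exists_two_ne (x y f : Fin 3 × Fin 3) (a b : SignType) (ha : a ≠ 0) (hb : b ≠ 0)
    (h : x = y → a = b) (h' : ¬(a = b ∧ sp9Sign x y = a)) :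
    ∃ z, sp9Sign z x = a ∧ sp9Sign z y = b ∧ z ≠ f := by
  -- Translations preserve signs, so `x = 0` may be assumed; this keeps the finite check small.
  have key : ∀ y f : Fin 3 × Fin 3, ∀ a b : SignType, a ≠ 0 → b ≠ 0 → (0 = y → a = b) →
      ¬(a = b ∧ sp9Sign 0 y = a) → ∃ z, sp9Sign z 0 = a ∧ sp9Sign z y = b ∧ z ≠ f := by
    decide +kernel
  obtain ⟨z, h₁, h₂, h₃⟩ := key (y - x) (f - x) a b ha hb
    (fun e => h (sub_eq_zero.1 e.symm).symm)
    (by rwa [← sp9Sign_add_left_eq, zero_add])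
  exact ⟨z + x, by simpa [sp9Sign_add_left_eq] using h₁, by simpa [sp9Sign_add_left_eq] using h₂,
    fun e => h₃ (eq_sub_iff_add_eq.2 e)⟩

theorem sp9_exists_line (x : Fin 3 × Fin 3) (s : SignType) (hs : s ≠ 0) :
    ∃ y, sp9Sign y x = s ∧ ∃ z, sp9Sign z x = s ∧ sp9Sign y z = s := by
  revert x s; decide +kernel

-- Recolours a triangle of sign `s` whose vertices `u₁`, `u₂` have outside neighbours coloured `x`,
-- `y`. In the excluded case `u` and `x` both complete the edge `u₁ u₂` to a triangle of sign `s`,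
-- which forces `u = x`.
set_option synthInstance.maxHeartbeats 400000 in
set_option synthInstance.maxSize 4000 in
theorem sp9_exists_triangle (x y f : Fin 3 × Fin 3) (a b s : SignType) (ha : a ≠ 0) (hb : b ≠ 0)
    (hs : s ≠ 0) (h : ¬(x = y ∧ a = s ∧ b = s)) :
    ∃ u, u ≠ f ∧ ∃ u₁, sp9Sign u₁ x = a ∧ sp9Sign u u₁ = s ∧
      ∃ u₂, sp9Sign u₂ y = b ∧ sp9Sign u₁ u₂ = s ∧ sp9Sign u u₂ = s := by
  have key : ∀ y f : Fin 3 × Fin 3, ∀ a b s : SignType, a ≠ 0 → b ≠ 0 → s ≠ 0 →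
      ¬(0 = y ∧ a = s ∧ b = s) →
      ∃ u, u ≠ f ∧ ∃ u₁, sp9Sign u₁ 0 = a ∧ sp9Sign u u₁ = s ∧
        ∃ u₂, sp9Sign u₂ y = b ∧ sp9Sign u₁ u₂ = s ∧ sp9Sign u u₂ = s := by
    decide +kernel
  obtain ⟨u, h₁, u₁, h₂, h₃, u₂, h₄, h₅, h₆⟩ := key (y - x) (f - x) a b s ha hb hs
    (fun e => h ⟨(sub_eq_zero.1 e.1.symm).symm, e.2⟩)
  refine ⟨u + x, fun e => h₁ (eq_sub_iff_add_eq.2 e), u₁ + x, ?_, ?_, u₂ + x, ?_, ?_, ?_⟩ <;>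
    simpa [sp9Sign_add_left_eq]

-- This and the next two lemmas serve a rooted diamond with one edge replaced by a path of length
-- two through `u`, both of whose edges have the opposite sign. The missing edge imposes no
-- condition of its own, which leaves `u` free to avoid `f`. Here the missing edge joins the root to
-- an end.
set_option synthInstance.maxHeartbeats 400000 in
set_option synthInstance.maxSize 4000 in
theorem sp9_diamond_root (P f : Fin 3 × Fin 3) (a t : SignType) (ha : a ≠ 0) (ht : t ≠ 0) :
    ∃ r, sp9Sign P r = -a ∧ ∃ q, ∃ q₁, sp9Sign q q₁ = t ∧ sp9Sign r q₁ = t ∧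
      ∃ q₂, sp9Sign q q₂ = t ∧ sp9Sign r q₂ = t ∧ sp9Sign q₁ q₂ = t ∧
      ∃ u, sp9Sign u P = -a ∧ sp9Sign u q = -a ∧ u ≠ f := by
  have key : ∀ f : Fin 3 × Fin 3, ∀ a t : SignType, a ≠ 0 → t ≠ 0 →
      ∃ r, sp9Sign 0 r = -a ∧ ∃ q, ∃ q₁, sp9Sign q q₁ = t ∧ sp9Sign r q₁ = t ∧
      ∃ q₂, sp9Sign q q₂ = t ∧ sp9Sign r q₂ = t ∧ sp9Sign q₁ q₂ = t ∧
      ∃ u, sp9Sign u 0 = -a ∧ sp9Sign u q = -a ∧ u ≠ f := by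
    decide +kernel
  obtain ⟨r, h₁, q, q₁, h₂, h₃, q₂, h₄, h₅, h₆, u, h₇, h₈, h₉⟩ := key (f - P) a t ha ht
  refine ⟨r + P, ?_, q + P, q₁ + P, ?_, ?_, q₂ + P, ?_, ?_, ?_, u + P, ?_, ?_, ?_⟩ <;>
    first
    | exact fun e => h₉ (eq_sub_iff_add_eq.2 e)
    | simpa [sp9Sign_add_left_eq, sp9Sign_add_right_eq]

-- The missing edge is `q q₁`.
set_option synthInstance.maxHeartbeats 400000 in
set_option synthInstance.maxSize 4000 in
theorem sp9_diamond_side (P f : Fin 3 × Fin 3) (a t : SignType) (ha : a ≠ 0) (ht : t ≠ 0) :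
    ∃ q, sp9Sign P q = a ∧ ∃ r, sp9Sign P r = -a ∧ ∃ q₁, sp9Sign r q₁ = t ∧
      ∃ q₂, sp9Sign q q₂ = t ∧ sp9Sign r q₂ = t ∧ sp9Sign q₁ q₂ = t ∧
      ∃ u, sp9Sign u q = -t ∧ sp9Sign u q₁ = -t ∧ u ≠ f := by
  have key : ∀ f : Fin 3 × Fin 3, ∀ a t : SignType, a ≠ 0 → t ≠ 0 →
      ∃ q, sp9Sign 0 q = a ∧ ∃ r, sp9Sign 0 r = -a ∧ ∃ q₁, sp9Sign r q₁ = t ∧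
      ∃ q₂, sp9Sign q q₂ = t ∧ sp9Sign r q₂ = t ∧ sp9Sign q₁ q₂ = t ∧
      ∃ u, sp9Sign u q = -t ∧ sp9Sign u q₁ = -t ∧ u ≠ f := by
    decide +kernel
  obtain ⟨q, h₁, r, h₂, q₁, h₃, q₂, h₄, h₅, h₆, u, h₇, h₈, h₉⟩ := key (f - P) a t ha ht
  refine ⟨q + P, ?_, r + P, ?_, q₁ + P, ?_, q₂ + P, ?_, ?_, ?_, u + P, ?_, ?_, ?_⟩ <;>
    first
    | exact fun e => h₉ (eq_sub_iff_add_eq.2 e)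
    | simpa [sp9Sign_add_left_eq, sp9Sign_add_right_eq]

-- The missing edge is `q₁ q₂`.
set_option synthInstance.maxHeartbeats 400000 in
set_option synthInstance.maxSize 4000 in
theorem sp9_diamond_middle (P f : Fin 3 × Fin 3) (a t : SignType) (ha : a ≠ 0) (ht : t ≠ 0) :
    ∃ q, sp9Sign P q = a ∧ ∃ r, sp9Sign P r = -a ∧ ∃ q₁, sp9Sign q q₁ = t ∧ sp9Sign r q₁ = t ∧
      ∃ q₂, sp9Sign q q₂ = t ∧ sp9Sign r q₂ = t ∧
      ∃ u, sp9Sign u q₁ = -t ∧ sp9Sign u q₂ = -t ∧ u ≠ f := by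
  have key : ∀ f : Fin 3 × Fin 3, ∀ a t : SignType, a ≠ 0 → t ≠ 0 →
      ∃ q, sp9Sign 0 q = a ∧ ∃ r, sp9Sign 0 r = -a ∧ ∃ q₁, sp9Sign q q₁ = t ∧ sp9Sign r q₁ = t ∧
      ∃ q₂, sp9Sign q q₂ = t ∧ sp9Sign r q₂ = t ∧
      ∃ u, sp9Sign u q₁ = -t ∧ sp9Sign u q₂ = -t ∧ u ≠ f := by
    decide +kernel
  obtain ⟨q, h₁, r, h₂, q₁, h₃, h₄, q₂, h₅, h₆, u, h₇, h₈, h₉⟩ := key (f - P) a t ha ht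
  refine ⟨q + P, ?_, r + P, ?_, q₁ + P, ?_, ?_, q₂ + P, ?_, ?_, u + P, ?_, ?_, ?_⟩ <;>
    first
    | exact fun e => h₉ (eq_sub_iff_add_eq.2 e)
    | simpa [sp9Sign_add_left_eq, sp9Sign_add_right_eq]

/-! ### Extensions of `SP₉` by one vertex -/

/-- The signs of an extension of `SP₉` by a new vertex, joined to `z` with sign `f z`. -/
def extSign (f : Fin 3 × Fin 3 → SignType) :
    Option (Fin 3 × Fin 3) → Option (Fin 3 × Fin 3) → SignType
  | some x, some y => sp9Sign x y
  | none, some y => f y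
  | some x, none => f x
  | none, none => 0

theorem extSign_comm (f : Fin 3 × Fin 3 → SignType) (x y : Option (Fin 3 × Fin 3)) :
    extSign f x y = extSign f y x := by
  cases x <;> cases y <;> simp [extSign, sp9Sign_comm]

theorem extSign_self (f : Fin 3 × Fin 3 → SignType) (x : Option (Fin 3 × Fin 3)) :
    extSign f x x = 0 := by
  cases x <;> simp [extSign]

/-- Signs at a new vertex for which every monochromatic diamond can be coloured. -/
def diamondSign (z : Fin 3 × Fin 3) : SignType :=
  if z.1 = 0 ∨ z = (1, 0) ∨ z = (2, 1) then 1 else -1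

theorem exists_extSign_one (x : Option (Fin 3 × Fin 3)) (a : SignType) (ha : a ≠ 0) :
    ∃ z, extSign diamondSign (some z) x = a := by
  revert x a; decide +kernel

/-- The signs at `P` force `q ≠ r`, which is impossible inside `SP₉`; so one of the four vertices
found is the new one. -/
theorem exists_extSign_diamond (P : Fin 3 × Fin 3) (a t : SignType) (ha : a ≠ 0) (ht : t ≠ 0) :
    ∃ q, extSign diamondSign (some P) q = a ∧ ∃ r, extSign diamondSign (some P) r = -a ∧
      ∃ q₁, extSign diamondSign q q₁ = t ∧ extSign diamondSign r q₁ = t ∧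
      ∃ q₂, extSign diamondSign q q₂ = t ∧ extSign diamondSign r q₂ = t ∧
        extSign diamondSign q₁ q₂ = t := by
  revert P a t; decide +kernel

/-! ### Signed graphs as sign matrices -/

theorem signType_ne_neg {a : SignType} (ha : a ≠ 0) : a ≠ -a := by
  revert a; decide

theorem signType_eq_or_eq_neg {a b : SignType} (ha : a ≠ 0) (hb : b ≠ 0) : b = a ∨ b = -a := by
  revert a b; decide

/-- A simple graph with signed edges, given by its symmetric sign matrix: the sign of a pair is
`0` exactly if the two vertices are not adjacent. -/
structure SignGraph (V : Type*) where
  /-- the sign matrix -/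
  sign : V → V → SignType
  symm : ∀ x y, sign x y = sign y x
  irrefl : ∀ x, sign x x = 0

namespace SignGraph

variable {V W : Type*} (σ : SignGraph V)

/-- `c` preserves the sign of every edge. -/
def IsHom (τ : W → W → SignType) (c : V → W) : Prop :=
  ∀ x y, σ.sign x y ≠ 0 → τ (c x) (c y) = σ.sign x y

/-- The vertex `x` has at most two neighbours in `S`. -/
def TwoNeighboursIn (S : Set V) (x : V) : Prop :=
  ∃ a b, ∀ y ∈ S, σ.sign x y ≠ 0 → y = a ∨ y = b

/-- Every vertex has at most three neighbours. -/
def Subcubic : Prop :=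
  ∀ x, ∃ a b c, ∀ y, σ.sign x y ≠ 0 → y = a ∨ y = b ∨ y = c

/-- Every nonempty set of vertices has a member with at most two neighbours in the set. -/
def Degenerate : Prop :=
  ∀ S : Set V, S.Nonempty → ∃ x ∈ S, σ.TwoNeighboursIn S x

/-- A monochromatic diamond: `K₄` without the edge `q r`, all edges of sign `t`. -/
structure Diamond (q r q₁ q₂ : V) (t : SignType) : Prop where
  ne_zero : t ≠ 0
  left_fst : σ.sign q q₁ = t
  left_snd : σ.sign q q₂ = t
  right_fst : σ.sign r q₁ = t
  right_snd : σ.sign r q₂ = t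
  middle : σ.sign q₁ q₂ = t

/-- A monochromatic diamond whose two ends are joined to `p` with different signs. -/
structure RootedDiamond (p q r q₁ q₂ : V) (a t : SignType) : Prop extends
    σ.Diamond q r q₁ q₂ t where
  root_ne_zero : a ≠ 0
  root_left : σ.sign p q = a
  root_right : σ.sign p r = -a

/-- No rooted diamond. -/
def DiamondFree : Prop :=
  ∀ p q r q₁ q₂ a t, ¬ σ.RootedDiamond p q r q₁ q₂ a t

/-- The vertices with at least one neighbour. -/
def support : Set V :=
  {x | ∃ y, σ.sign x y ≠ 0}

/-- The hypotheses under which a homomorphism to `SP₉` exists. -/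
structure Good : Prop where
  subcubic : σ.Subcubic
  degenerate : σ.Degenerate
  diamondFree : σ.DiamondFree

open scoped Classical in
/-- Delete all edges that meet `T`. -/
noncomputable def isolate (T : Set V) : SignGraph V where
  sign x y := if x ∈ T ∨ y ∈ T then 0 else σ.sign x y
  symm x y := by simp only [or_comm, σ.symm]
  irrefl x := by simp [σ.irrefl]

open scoped Classical in
/-- Set the sign of the pair `a b`. -/
noncomputable def setSign (a b : V) (s : SignType) (hab : a ≠ b) : SignGraph V where
  sign x y := if (x = a ∧ y = b) ∨ (x = b ∧ y = a) then s else σ.sign x y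
  symm x y := by
    have : ((x = a ∧ y = b) ∨ (x = b ∧ y = a)) ↔ ((y = a ∧ x = b) ∨ (y = b ∧ x = a)) := by tauto
    simp only [this, σ.symm x y]
  irrefl x := by
    have : ¬((x = a ∧ x = b) ∨ (x = b ∧ x = a)) := by
      rintro (⟨h, h'⟩ | ⟨h, h'⟩)
      · exact hab (h.symm.trans h')
      · exact hab (h'.symm.trans h)
    simp only [if_neg this, σ.irrefl]

variable {σ}

theorem ne_of_sign {x y : V} (h : σ.sign x y ≠ 0) : x ≠ y := by
  rintro rfl
  exact h (σ.irrefl x)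

theorem isolate_sign {T : Set V} {x y : V} (hx : x ∉ T) (hy : y ∉ T) :
    (σ.isolate T).sign x y = σ.sign x y := by
  simp [isolate, hx, hy]

theorem isolate_sign_left {T : Set V} {x y : V} (hx : x ∈ T) :
    (σ.isolate T).sign x y = 0 := by
  simp [isolate, hx]

theorem isolate_sign_ne_zero {T : Set V} {x y : V} :
    (σ.isolate T).sign x y ≠ 0 ↔ x ∉ T ∧ y ∉ T ∧ σ.sign x y ≠ 0 := by
  by_cases hx : x ∈ T <;> by_cases hy : y ∈ T <;> simp [isolate, hx, hy]

/-- `σ'` is obtained from `σ` by deleting edges. -/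
def IsSubgraph (σ' σ : SignGraph V) : Prop :=
  ∀ x y, σ'.sign x y ≠ 0 → σ'.sign x y = σ.sign x y

theorem isolate_isSubgraph (σ : SignGraph V) (T : Set V) : (σ.isolate T).IsSubgraph σ := by
  intro x y h
  obtain ⟨hx, hy, -⟩ := isolate_sign_ne_zero.1 h
  exact isolate_sign hx hy

theorem setSign_sign {a b : V} {s : SignType} {hab : a ≠ b} :
    (σ.setSign a b s hab).sign a b = s := by
  simp [setSign]

theorem setSign_sign_of_ne {a b x y : V} {s : SignType} {hab : a ≠ b}
    (h : ¬((x = a ∧ y = b) ∨ (x = b ∧ y = a))) :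
    (σ.setSign a b s hab).sign x y = σ.sign x y := by
  simp only [setSign, if_neg h]

theorem setSign_zero_isSubgraph (σ : SignGraph V) {a b : V} (hab : a ≠ b) :
    (σ.setSign a b 0 hab).IsSubgraph σ := by
  intro x y h
  by_cases h' : (x = a ∧ y = b) ∨ (x = b ∧ y = a)
  · simp only [setSign, if_pos h', ne_eq, not_true_eq_false] at h
  · exact setSign_sign_of_ne h'

theorem setSign_comm {a b : V} {s : SignType} (hab : a ≠ b) :
    σ.setSign a b s hab = σ.setSign b a s hab.symm := by
  simp only [setSign, SignGraph.mk.injEq]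
  funext x y
  classical exact if_congr or_comm rfl rfl

namespace IsSubgraph

variable {σ' : SignGraph V}

theorem ne_zero (h : σ'.IsSubgraph σ) {x y : V} (hxy : σ'.sign x y ≠ 0) : σ.sign x y ≠ 0 := by
  rwa [← h x y hxy]

theorem isHom (h : σ'.IsSubgraph σ) {τ : W → W → SignType} {c : V → W} (hc : σ.IsHom τ c) :
    σ'.IsHom τ c := fun x y hxy => by
  rw [h x y hxy, hc x y (h.ne_zero hxy)]

theorem subcubic (h : σ'.IsSubgraph σ) (hσ : σ.Subcubic) : σ'.Subcubic := fun x => by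
  obtain ⟨a, b, c, habc⟩ := hσ x
  exact ⟨a, b, c, fun y hy => habc y (h.ne_zero hy)⟩

theorem twoNeighboursIn (h : σ'.IsSubgraph σ) {S : Set V} {x : V} (hσ : σ.TwoNeighboursIn S x) :
    σ'.TwoNeighboursIn S x := by
  obtain ⟨a, b, hab⟩ := hσ
  exact ⟨a, b, fun y hy hxy => hab y hy (h.ne_zero hxy)⟩

theorem degenerate (h : σ'.IsSubgraph σ) (hσ : σ.Degenerate) : σ'.Degenerate := fun S hS => by
  obtain ⟨x, hx, hx'⟩ := hσ S hS
  exact ⟨x, hx, h.twoNeighboursIn hx'⟩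

theorem diamond (h : σ'.IsSubgraph σ) {q r q₁ q₂ : V} {t : SignType}
    (hd : σ'.Diamond q r q₁ q₂ t) : σ.Diamond q r q₁ q₂ t := by
  obtain ⟨h0, h1, h2, h3, h4, h5⟩ := hd
  have key : ∀ x y, σ'.sign x y = t → σ.sign x y = t := fun x y e => by
    rw [← h x y (by rwa [e]), e]
  exact ⟨h0, key _ _ h1, key _ _ h2, key _ _ h3, key _ _ h4, key _ _ h5⟩

theorem diamondFree (h : σ'.IsSubgraph σ) (hσ : σ.DiamondFree) : σ'.DiamondFree := by
  intro p q r q₁ q₂ a t ⟨hd, h0, h1, h2⟩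
  refine hσ p q r q₁ q₂ a t ⟨h.diamond hd, h0, ?_, ?_⟩
  · rw [← h _ _ (by rwa [h1]), h1]
  · rw [← h _ _ (by rw [h2]; simpa using h0), h2]

theorem good (h : σ'.IsSubgraph σ) (hσ : σ.Good) : σ'.Good :=
  ⟨h.subcubic hσ.1, h.degenerate hσ.2, h.diamondFree hσ.3⟩

end IsSubgraph

theorem support_isolate_subset (σ : SignGraph V) (T : Set V) :
    (σ.isolate T).support ⊆ σ.support \ T := fun _ ⟨y, hy⟩ =>
  have h := isolate_sign_ne_zero.1 hy
  ⟨⟨y, h.2.2⟩, h.1⟩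

theorem ncard_support_isolate_lt [Finite V] {v : V} (hv : v ∈ σ.support) {T : Set V}
    (hT : v ∈ T) : (σ.isolate T).support.ncard < σ.support.ncard :=
  Set.ncard_lt_ncard ((Set.ssubset_iff_of_subset
    ((support_isolate_subset σ T).trans Set.sdiff_subset)).2
      ⟨v, hv, fun h => (support_isolate_subset σ T h).2 hT⟩) (Set.toFinite _)

theorem Subcubic.eq_or_eq_or_eq (hσ : σ.Subcubic) {x a b c : V} (ha : σ.sign x a ≠ 0)
    (hb : σ.sign x b ≠ 0) (hc : σ.sign x c ≠ 0) (hab : a ≠ b) (hac : a ≠ c) (hbc : b ≠ c)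
    {y : V} (hy : σ.sign x y ≠ 0) : y = a ∨ y = b ∨ y = c := by
  obtain ⟨a', b', c', h⟩ := hσ x
  have := h a ha; have := h b hb; have := h c hc; have := h y hy
  grind

theorem TwoNeighboursIn.false_of_three {x a b c : V} (h : σ.TwoNeighboursIn Set.univ x)
    (ha : σ.sign x a ≠ 0) (hb : σ.sign x b ≠ 0) (hc : σ.sign x c ≠ 0) (hab : a ≠ b)
    (hac : a ≠ c) (hbc : b ≠ c) : False := by
  obtain ⟨a', b', h⟩ := h
  have := h a trivial ha; have := h b trivial hb; have := h c trivial hc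
  grind

/-- A map that is a homomorphism away from `T` and on the edges at `T` is a homomorphism. -/
theorem IsHom.extend {τ : W → W → SignType} (hτ : ∀ x y, τ x y = τ y x) {T : Set V} {c c' : V → W}
    (hc : (σ.isolate T).IsHom τ c) (h : ∀ x, x ∉ T → c' x = c x)
    (hT : ∀ x ∈ T, ∀ y, σ.sign x y ≠ 0 → τ (c' x) (c' y) = σ.sign x y) : σ.IsHom τ c' := by
  intro x y hxy
  by_cases hx : x ∈ T
  · exact hT x hx y hxy
  by_cases hy : y ∈ T
  · rw [hτ, σ.symm]
    exact hT y hy x (by rwa [σ.symm])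
  · rw [h x hx, h y hy, ← isolate_sign hx hy]
    exact hc x y (by rwa [isolate_sign hx hy])

open scoped Classical in
/-- Extend a homomorphism to one more vertex. -/
theorem IsHom.extend_one {τ : W → W → SignType} (hτ : ∀ x y, τ x y = τ y x) {v : V} {c : V → W}
    (hc : (σ.isolate {v}).IsHom τ c) {z : W}
    (hz : ∀ y, σ.sign v y ≠ 0 → τ z (c y) = σ.sign v y) : σ.IsHom τ (Function.update c v z) := by
  refine IsHom.extend hτ hc (fun x hx => Function.update_of_ne hx z c) ?_
  rintro x rfl y hy
  rw [Function.update_self, Function.update_of_ne (ne_of_sign hy).symm]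
  exact hz y hy

theorem IsHom.sign_ne {c : V → Fin 3 × Fin 3} (hc : σ.IsHom sp9Sign c) {x y : V}
    (h : σ.sign x y ≠ 0) : c x ≠ c y := by
  intro e
  apply h
  rw [← hc x y h, e, sp9Sign_self]

end SignGraph

/-! ### Tied vertices, forks and rooted diamonds -/

namespace SignGraph

variable {V : Type*} {σ : SignGraph V}

/-- All homomorphisms to `SP₉` agree at `u` and `w`. -/
def Tied (σ : SignGraph V) (u w : V) : Prop :=
  ∀ c, σ.IsHom sp9Sign c → c u = c w

/-- The neighbours of `u` are `u₁` and `u₂`, both joined to `u` with sign `s`. -/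
structure Fork (σ : SignGraph V) (u u₁ u₂ : V) (s : SignType) : Prop where
  ne_zero : s ≠ 0
  ne : u₁ ≠ u₂
  fst : σ.sign u u₁ = s
  snd : σ.sign u u₂ = s
  eq_or_eq : ∀ y, σ.sign u y ≠ 0 → y = u₁ ∨ y = u₂

/-- A union of components containing `u` but not `w` can be translated on its own, which separates
their colours. -/
theorem Tied.false_of_closed {u w : V} (ht : σ.Tied u w) {c : V → Fin 3 × Fin 3}
    (hc : σ.IsHom sp9Sign c) {T : Set V} (hT : ∀ x ∈ T, ∀ y, σ.sign x y ≠ 0 → y ∈ T)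
    (hu : u ∈ T) (hw : w ∉ T) : False := by
  classical
  have hc' : σ.IsHom sp9Sign (fun x => if x ∈ T then c x + (0, 1) else c x) := by
    intro x y hxy
    by_cases hx : x ∈ T
    · simp only [if_pos hx, if_pos (hT x hx y hxy), sp9Sign_add_right, hc x y hxy]
    · have hy : y ∉ T := fun hy => hx (hT y hy x (by rwa [σ.symm]))
      simp only [if_neg hx, if_neg hy, hc x y hxy]
  have h := ht _ hc'
  simp only [if_pos hu, if_neg hw, ht c hc] at h
  revert h
  generalize c w = z
  revert z
  decide

/-- Recolouring `u` alone cannot change its colour if `u` and `w` are tied. -/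
theorem Tied.eq_of_isolate {u w : V} (ht : σ.Tied u w) (huw : u ≠ w) {c : V → Fin 3 × Fin 3}
    (hc : (σ.isolate {u}).IsHom sp9Sign c) {z : Fin 3 × Fin 3}
    (hz : ∀ y, σ.sign u y ≠ 0 → sp9Sign z (c y) = σ.sign u y) : z = c w := by
  classical
  have h := ht _ (hc.extend_one sp9Sign_comm hz)
  rwa [Function.update_self, Function.update_of_ne huw.symm] at h

/-- Any other configuration at `u` leaves at least two colours for `u` while the remaining vertices
stay fixed, so one of them differs from the colour of `w`. -/
theorem Tied.exists_fork {u w : V} (ht : σ.Tied u w) (huw : u ≠ w)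
    (hu : σ.TwoNeighboursIn Set.univ u) {c₀ : V → Fin 3 × Fin 3} (hc₀ : σ.IsHom sp9Sign c₀) :
    ∃ u₁ u₂ s, σ.Fork u u₁ u₂ s ∧ ∀ c : V → Fin 3 × Fin 3, (σ.isolate {u}).IsHom sp9Sign c →
      sp9Sign (c u₁) (c u₂) = s := by
  obtain ⟨a, b, hab⟩ := hu
  replace hab : ∀ y, σ.sign u y ≠ 0 → y = a ∨ y = b := fun y => hab y trivial
  have hi := (isolate_isSubgraph σ {u}).isHom hc₀
  have one : ∀ x, ¬ ∀ y, σ.sign u y ≠ 0 → y = x := by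
    intro x hx
    by_cases h : σ.sign u x = 0
    · obtain ⟨z, -, hz⟩ := sp9_exists_one 0 (c₀ w) 1 (by decide)
      exact hz (ht.eq_of_isolate huw hi fun y hy => absurd h (hx y hy ▸ hy))
    · obtain ⟨z, hz', hz⟩ := sp9_exists_one (c₀ x) (c₀ w) _ h
      exact hz (ht.eq_of_isolate huw hi fun y hy => by rw [hx y hy, hz'])
  have ha : σ.sign u a ≠ 0 := fun h => one b fun y hy => (hab y hy).resolve_left
    fun e => hy (e ▸ h)
  have hb : σ.sign u b ≠ 0 := fun h => one a fun y hy => (hab y hy).resolve_right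
    fun e => hy (e ▸ h)
  have hne : a ≠ b := fun h => one b fun y hy => (hab y hy).elim (fun e => e.trans h) id
  have two : ∀ c : V → Fin 3 × Fin 3, (σ.isolate {u}).IsHom sp9Sign c →
      (c a = c b → σ.sign u a = σ.sign u b) →
      σ.sign u a = σ.sign u b ∧ sp9Sign (c a) (c b) = σ.sign u a := by
    intro c hc h
    by_contra h'
    obtain ⟨z, h₁, h₂, h₃⟩ := sp9_exists_two_ne (c a) (c b) (c w) _ _ ha hb h h'
    refine h₃ (ht.eq_of_isolate huw hc fun y hy => ?_)
    rcases hab y hy with rfl | rfl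
    exacts [h₁, h₂]
  have hs : σ.sign u a = σ.sign u b := (two c₀ hi fun e => by
    rw [← hc₀ u a ha, ← hc₀ u b hb, e]).1
  exact ⟨a, b, _, ⟨ha, hne, rfl, hs.symm, hab⟩, fun c hc => (two c hc fun _ => hs).2⟩

theorem RootedDiamond.swap_ends {p q r q₁ q₂ : V} {a t : SignType}
    (h : σ.RootedDiamond p q r q₁ q₂ a t) : σ.RootedDiamond p r q q₁ q₂ (-a) t := by
  obtain ⟨⟨h0, h1, h2, h3, h4, h5⟩, h6, h7, h8⟩ := h
  exact ⟨⟨h0, h3, h4, h1, h2, h5⟩, by simpa, h8, by simpa⟩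

theorem RootedDiamond.swap_middle {p q r q₁ q₂ : V} {a t : SignType}
    (h : σ.RootedDiamond p q r q₁ q₂ a t) : σ.RootedDiamond p q r q₂ q₁ a t := by
  obtain ⟨⟨h0, h1, h2, h3, h4, h5⟩, h6, h7, h8⟩ := h
  exact ⟨⟨h0, h2, h1, h4, h3, by rwa [σ.symm]⟩, h6, h7, h8⟩

/-- In a rooted diamond all vertices are distinct. -/
theorem RootedDiamond.ne {p q r q₁ q₂ : V} {a t : SignType}
    (h : σ.RootedDiamond p q r q₁ q₂ a t) :
    p ≠ q ∧ p ≠ r ∧ p ≠ q₁ ∧ p ≠ q₂ ∧ q ≠ r ∧ q ≠ q₁ ∧ q ≠ q₂ ∧ r ≠ q₁ ∧ r ≠ q₂ ∧ q₁ ≠ q₂ := by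
  obtain ⟨⟨h0, h1, h2, h3, h4, h5⟩, h6, h7, h8⟩ := h
  have hn := signType_ne_neg h6
  refine ⟨?_, ?_, ?_, ?_, ?_, ?_, ?_, ?_, ?_, ?_⟩ <;> rintro rfl
  · exact h6 (by rw [← h7, σ.irrefl])
  · exact h6 (by rw [σ.irrefl] at h8; simpa using h8.symm)
  · rw [σ.symm] at h1 h3; exact hn ((h7.symm.trans h1).trans (h3.symm.trans h8))
  · rw [σ.symm] at h2 h4; exact hn ((h7.symm.trans h2).trans (h4.symm.trans h8))
  · exact hn (h7.symm.trans h8)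
  · exact h0 (by rw [← h1, σ.irrefl])
  · exact h0 (by rw [← h2, σ.irrefl])
  · exact h0 (by rw [← h3, σ.irrefl])
  · exact h0 (by rw [← h4, σ.irrefl])
  · exact h0 (by rw [← h5, σ.irrefl])

/-- The neighbours of the vertices of a rooted diamond in a subcubic graph. -/
theorem RootedDiamond.neighbours {p q r q₁ q₂ : V} {a t : SignType}
    (h : σ.RootedDiamond p q r q₁ q₂ a t) (hσ : σ.Subcubic) :
    (∀ y, σ.sign q y ≠ 0 → y = p ∨ y = q₁ ∨ y = q₂) ∧
    (∀ y, σ.sign r y ≠ 0 → y = p ∨ y = q₁ ∨ y = q₂) ∧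
    (∀ y, σ.sign q₁ y ≠ 0 → y = q ∨ y = r ∨ y = q₂) ∧
    (∀ y, σ.sign q₂ y ≠ 0 → y = q ∨ y = r ∨ y = q₁) := by
  obtain ⟨n1, n2, n3, n4, n5, n6, n7, n8, n9, n10⟩ := h.ne
  obtain ⟨⟨h0, h1, h2, h3, h4, h5⟩, h6, h7, h8⟩ := h
  have h6' : -a ≠ 0 := by simpa
  refine ⟨fun y => hσ.eq_or_eq_or_eq ?_ ?_ ?_ n3 n4 n10,
    fun y => hσ.eq_or_eq_or_eq ?_ ?_ ?_ n3 n4 n10,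
    fun y => hσ.eq_or_eq_or_eq ?_ ?_ ?_ n5 n7 n9, fun y => hσ.eq_or_eq_or_eq ?_ ?_ ?_ n5 n6 n8⟩ <;>
  first
  | (simp only [h1, h2, h3, h4, h5]; assumption)
  | (rw [σ.symm]; simp only [h1, h2, h3, h4, h5, h7, h8]; assumption)

/-- The vertices of a rooted diamond other than the root have three neighbours. -/
theorem RootedDiamond.ne_of_twoNeighboursIn {p q r q₁ q₂ : V} {a t : SignType}
    (h : σ.RootedDiamond p q r q₁ q₂ a t) {w : V} (hw : σ.TwoNeighboursIn Set.univ w) :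
    w ≠ q ∧ w ≠ r ∧ w ≠ q₁ ∧ w ≠ q₂ := by
  obtain ⟨n1, n2, n3, n4, n5, n6, n7, n8, n9, n10⟩ := h.ne
  obtain ⟨⟨h0, h1, h2, h3, h4, h5⟩, h6, h7, h8⟩ := h
  have h6' : -a ≠ 0 := by simpa
  refine ⟨?_, ?_, ?_, ?_⟩ <;> rintro rfl
  · exact hw.false_of_three (by rwa [σ.symm, h7]) (by rwa [h1]) (by rwa [h2]) n3 n4 n10
  · exact hw.false_of_three (by rwa [σ.symm, h8]) (by rwa [h3]) (by rwa [h4]) n3 n4 n10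
  · exact hw.false_of_three (by rwa [σ.symm, h1]) (by rwa [σ.symm, h3]) (by rwa [h5]) n5 n7 n9
  · exact hw.false_of_three (by rwa [σ.symm, h2]) (by rwa [σ.symm, h4]) (by rwa [σ.symm, h5])
      n5 n6 n8

theorem Subcubic.mem_of_not_twoNeighboursIn (hσ : σ.Subcubic) {S : Set V} {x y : V}
    (h : ¬ σ.TwoNeighboursIn S x) (hy : σ.sign x y ≠ 0) : y ∈ S := by
  obtain ⟨a, b, c, habc⟩ := hσ x
  by_contra hyS
  rcases habc y hy with rfl | rfl | rfl
  · exact h ⟨b, c, fun z hz h' => (habc z h').resolve_left fun e => hyS (e ▸ hz)⟩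
  · exact h ⟨a, c, fun z hz h' => by
      rcases habc z h' with e | e | e
      exacts [.inl e, absurd (e ▸ hz) hyS, .inr e]⟩
  · exact h ⟨a, b, fun z hz h' => by
      rcases habc z h' with e | e | e
      exacts [.inl e, .inr e, absurd (e ▸ hz) hyS]⟩

/-- Degree bounds survive when a neighbour `u` is traded for `z`. -/
theorem exists_three_of_exchange {P Q : V → Prop} {u z : V}
    (hP : ∃ a b c, ∀ y, P y → y = a ∨ y = b ∨ y = c)
    (hu : P u) (h : ∀ y, Q y → y = z ∨ (P y ∧ y ≠ u)) :
    ∃ a b c, ∀ y, Q y → y = a ∨ y = b ∨ y = c := by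
  obtain ⟨a, b, c, habc⟩ := hP
  rcases habc u hu with rfl | rfl | rfl
  · exact ⟨z, b, c, fun y hy => by have := h y hy; have := habc y; tauto⟩
  · exact ⟨a, z, c, fun y hy => by have := h y hy; have := habc y; tauto⟩
  · exact ⟨a, b, z, fun y hy => by have := h y hy; have := habc y; tauto⟩

theorem exists_two_of_exchange {P Q : V → Prop} {u z : V} (hP : ∃ a b, ∀ y, P y → y = a ∨ y = b)
    (hu : P u) (h : ∀ y, Q y → y = z ∨ (P y ∧ y ≠ u)) : ∃ a b, ∀ y, Q y → y = a ∨ y = b := by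
  obtain ⟨a, b, hab⟩ := hP
  rcases hab u hu with rfl | rfl
  · exact ⟨z, b, fun y hy => by have := h y hy; have := hab y; tauto⟩
  · exact ⟨a, z, fun y hy => by have := h y hy; have := hab y; tauto⟩

end SignGraph

/-! ### Contracting a fork with non-adjacent ends -/

namespace SignGraph

variable {V : Type*} {σ : SignGraph V}

theorem isSubgraph_setSign {a b : V} {s : SignType} (hab : a ≠ b) (h : σ.sign a b = 0) :
    σ.IsSubgraph (σ.setSign a b s hab) := by
  intro x y hxy
  refine (setSign_sign_of_ne ?_).symm
  rintro (⟨rfl, rfl⟩ | ⟨rfl, rfl⟩)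
  · exact hxy h
  · exact hxy (by rwa [σ.symm])

namespace Fork

variable {u u₁ u₂ w : V} {s : SignType}

theorem swap (h : σ.Fork u u₁ u₂ s) : σ.Fork u u₂ u₁ s :=
  ⟨h.1, h.2.symm, h.4, h.3, fun y hy => (h.5 y hy).symm⟩

theorem ne_fst (h : σ.Fork u u₁ u₂ s) : u ≠ u₁ :=
  ne_of_sign (by rw [h.fst]; exact h.ne_zero)

theorem ne_snd (h : σ.Fork u u₁ u₂ s) : u ≠ u₂ :=
  h.swap.ne_fst

/-- Replace the path `u₁ u u₂` by an edge of the other sign. -/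
noncomputable def contract (h : σ.Fork u u₁ u₂ s) : SignGraph V :=
  (σ.isolate {u}).setSign u₁ u₂ (-s) h.ne

theorem contract_swap (h : σ.Fork u u₁ u₂ s) : h.swap.contract = h.contract :=
  setSign_comm h.swap.ne

theorem contract_sign (h : σ.Fork u u₁ u₂ s) : h.contract.sign u₁ u₂ = -s :=
  setSign_sign

theorem contract_sign_left (h : σ.Fork u u₁ u₂ s) (y : V) : h.contract.sign u y = 0 := by
  rw [contract, setSign_sign_of_ne, isolate_sign_left (Set.mem_singleton u)]
  rintro (⟨e, -⟩ | ⟨e, -⟩)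
  exacts [h.ne_fst e, h.ne_snd e]

theorem contract_sign_of_ne (h : σ.Fork u u₁ u₂ s) {x y : V} (hx : x ≠ u) (hy : y ≠ u)
    (hxy : ¬((x = u₁ ∧ y = u₂) ∨ (x = u₂ ∧ y = u₁))) : h.contract.sign x y = σ.sign x y := by
  rw [contract, setSign_sign_of_ne hxy]
  exact isolate_sign hx hy

theorem contract_sign_ne_zero (h : σ.Fork u u₁ u₂ s) {x y : V} (hxy : h.contract.sign x y ≠ 0) :
    (x = u₁ ∧ y = u₂) ∨ (x = u₂ ∧ y = u₁) ∨ (σ.sign x y ≠ 0 ∧ x ≠ u ∧ y ≠ u) := by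
  by_cases h' : (x = u₁ ∧ y = u₂) ∨ (x = u₂ ∧ y = u₁)
  · tauto
  · rw [contract, setSign_sign_of_ne h'] at hxy
    obtain ⟨hx, hy, hxy⟩ := isolate_sign_ne_zero.1 hxy
    exact .inr (.inr ⟨hxy, hx, hy⟩)

theorem isolate_isSubgraph_contract (h : σ.Fork u u₁ u₂ s) (h0 : σ.sign u₁ u₂ = 0) :
    (σ.isolate {u}).IsSubgraph h.contract :=
  isSubgraph_setSign h.ne ((isolate_sign (T := {u}) h.ne_fst.symm h.ne_snd.symm).trans h0)

theorem sign_eq_contract (h : σ.Fork u u₁ u₂ s) (h0 : σ.sign u₁ u₂ = 0) {x y : V}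
    (hx : x ≠ u) (hy : y ≠ u) (hxy : σ.sign x y ≠ 0) : h.contract.sign x y = σ.sign x y := by
  have hi : (σ.isolate {u}).sign x y = σ.sign x y := isolate_sign hx hy
  rw [← h.isolate_isSubgraph_contract h0 x y (by rwa [hi]), hi]

theorem sign_fst_ne_zero (h : σ.Fork u u₁ u₂ s) : σ.sign u₁ u ≠ 0 := by
  rw [σ.symm, h.fst]; exact h.ne_zero

theorem contract_support_subset (h : σ.Fork u u₁ u₂ s) : h.contract.support ⊆ σ.support := by
  rintro x ⟨y, hy⟩
  rcases h.contract_sign_ne_zero hy with ⟨rfl, -⟩ | ⟨rfl, -⟩ | ⟨hy, -⟩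
  exacts [⟨u, h.sign_fst_ne_zero⟩, ⟨u, h.swap.sign_fst_ne_zero⟩, ⟨y, hy⟩]

/-- Contracting a fork exchanges the neighbour `u` of `u₁` for `u₂` and vice versa. -/
theorem exchange (h : σ.Fork u u₁ u₂ s) (x : V) :
    (∀ y, h.contract.sign x y ≠ 0 → σ.sign x y ≠ 0) ∨
      (σ.sign x u ≠ 0 ∧ ∃ z, ∀ y, h.contract.sign x y ≠ 0 → y = z ∨ (σ.sign x y ≠ 0 ∧ y ≠ u)) := by
  have hne := h.ne
  by_cases h₁ : x = u₁
  · subst h₁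
    refine .inr ⟨h.sign_fst_ne_zero, u₂, fun y hy => ?_⟩
    have := h.contract_sign_ne_zero hy
    tauto
  by_cases h₂ : x = u₂
  · subst h₂
    refine .inr ⟨h.swap.sign_fst_ne_zero, u₁, fun y hy => ?_⟩
    have := h.contract_sign_ne_zero hy
    tauto
  · refine .inl fun y hy => ?_
    have := h.contract_sign_ne_zero hy
    tauto

theorem contract_subcubic (h : σ.Fork u u₁ u₂ s) (hσ : σ.Subcubic) : h.contract.Subcubic := by
  intro x
  rcases h.exchange x with h' | ⟨hu, z, hz⟩
  · obtain ⟨a, b, c, habc⟩ := hσ x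
    exact ⟨a, b, c, fun y hy => habc y (h' y hy)⟩
  · exact exists_three_of_exchange (hσ x) hu hz

theorem contract_twoNeighboursIn (h : σ.Fork u u₁ u₂ s) {x : V}
    (hx : σ.TwoNeighboursIn Set.univ x) : h.contract.TwoNeighboursIn Set.univ x := by
  rcases h.exchange x with h' | ⟨hu, z, hz⟩
  · obtain ⟨a, b, hab⟩ := hx
    exact ⟨a, b, fun y hy hxy => hab y hy (h' y hxy)⟩
  · obtain ⟨a, b, hab⟩ := hx
    obtain ⟨a, b, hab⟩ := exists_two_of_exchange ⟨a, b, fun y => hab y trivial⟩ hu hz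
    exact ⟨a, b, fun y _ => hab y⟩

/-- A set `S` violating degeneracy is a union of cubic components of the contracted graph, so it
misses `w`. It must contain the new edge; then adding `u` gives a union of components of `σ`,
contradicting `Tied.false_of_closed`. -/
theorem contract_degenerate (h : σ.Fork u u₁ u₂ s) (hσ : σ.Subcubic) (hd : σ.Degenerate)
    (h0 : σ.sign u₁ u₂ = 0) (huw : u ≠ w) (hw : σ.TwoNeighboursIn Set.univ w)
    (ht : σ.Tied u w) {c : V → Fin 3 × Fin 3} (hc : σ.IsHom sp9Sign c) :
    h.contract.Degenerate := by
  intro S hS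
  by_contra! hS'
  have hwS : w ∉ S := fun hwS => hS' w hwS (by
    obtain ⟨a, b, hab⟩ := h.contract_twoNeighboursIn hw
    exact ⟨a, b, fun y _ => hab y trivial⟩)
  have hmem : ∀ x ∈ S, ∀ y, h.contract.sign x y ≠ 0 → y ∈ S := fun x hx y hy =>
    (h.contract_subcubic hσ).mem_of_not_twoNeighboursIn (hS' x hx) hy
  by_cases hu : u₁ ∈ S ∧ u₂ ∈ S
  · refine ht.false_of_closed hc (T := insert u S) ?_ (Set.mem_insert _ _) ?_
    · rintro x (rfl | hx) y hy
      · rcases h.eq_or_eq y hy with rfl | rfl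
        exacts [.inr hu.1, .inr hu.2]
      · by_cases hyu : y = u
        · exact .inl hyu
        by_cases hxu : x = u
        · subst hxu
          rcases h.eq_or_eq y hy with rfl | rfl
          exacts [.inr hu.1, .inr hu.2]
        · exact .inr (hmem x hx y (by rwa [h.sign_eq_contract h0 hxu hyu hy]))
    · rintro (e | e)
      exacts [huw e.symm, hwS e]
  · obtain ⟨x, hx, a, b, hab⟩ := hd S hS
    refine hS' x hx ⟨a, b, fun y hy hxy => hab y hy ?_⟩
    rcases h.contract_sign_ne_zero hxy with ⟨rfl, rfl⟩ | ⟨rfl, rfl⟩ | ⟨hxy, -⟩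
    exacts [absurd ⟨hx, hy⟩ hu, absurd ⟨hy, hx⟩ hu, hxy]

open scoped Classical in
/-- The colouring `c`, changed at five vertices. -/
noncomputable def recolour (c : V → Fin 3 × Fin 3) (u q r q₁ q₂ : V)
    (U Q R Q₁ Q₂ : Fin 3 × Fin 3) (x : V) : Fin 3 × Fin 3 :=
  if x = u then U else if x = q then Q else if x = r then R else if x = q₁ then Q₁ else
    if x = q₂ then Q₂ else c x

/-- A rooted diamond created by contracting a fork can be recoloured so that `u` changes. -/
theorem recolour_false (h : σ.Fork u u₁ u₂ s) (hσ : σ.Subcubic) (h0 : σ.sign u₁ u₂ = 0)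
    (huw : u ≠ w) (hw : σ.TwoNeighboursIn Set.univ w) (ht : σ.Tied u w)
    {c : V → Fin 3 × Fin 3} (hc : σ.IsHom sp9Sign c) {p q r q₁ q₂ : V} {a t : SignType}
    (hR : h.contract.RootedDiamond p q r q₁ q₂ a t) {U Q R Q₁ Q₂ : Fin 3 × Fin 3}
    (hU : U ≠ c w) (hpq : σ.sign p q ≠ 0 → sp9Sign (c p) Q = a)
    (hpr : σ.sign p r ≠ 0 → sp9Sign (c p) R = -a) (hqq₁ : σ.sign q q₁ ≠ 0 → sp9Sign Q Q₁ = t)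
    (hqq₂ : σ.sign q q₂ ≠ 0 → sp9Sign Q Q₂ = t) (hrq₁ : σ.sign r q₁ ≠ 0 → sp9Sign R Q₁ = t)
    (hrq₂ : σ.sign r q₂ ≠ 0 → sp9Sign R Q₂ = t) (hq₁q₂ : σ.sign q₁ q₂ ≠ 0 → sp9Sign Q₁ Q₂ = t)
    (hU₁ : sp9Sign U (recolour c u q r q₁ q₂ U Q R Q₁ Q₂ u₁) = s)
    (hU₂ : sp9Sign U (recolour c u q r q₁ q₂ U Q R Q₁ Q₂ u₂) = s) : False := by
  obtain ⟨n1, n2, n3, n4, n5, n6, n7, n8, n9, n10⟩ := hR.ne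
  obtain ⟨w1, w2, w3, w4⟩ := hR.ne_of_twoNeighboursIn (h.contract_twoNeighboursIn hw)
  obtain ⟨N1, N2, N3, N4⟩ := hR.neighbours (h.contract_subcubic hσ)
  obtain ⟨⟨k0, k1, k2, k3, k4, k5⟩, k6, k7, k8⟩ := hR
  have hu : ∀ {x y z}, h.contract.sign x y = z → z ≠ 0 → x ≠ u ∧ y ≠ u := by
    rintro x y z e hz
    refine ⟨?_, ?_⟩ <;> rintro rfl
    · exact hz (by rw [← e, h.contract_sign_left])
    · exact hz (by rw [← e, h.contract.symm, h.contract_sign_left])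
  obtain ⟨up, uq⟩ := hu k7 k6
  obtain ⟨ur, uq₁⟩ := hu k3 k0
  obtain ⟨-, uq₂⟩ := hu k4 k0
  set k := recolour c u q r q₁ q₂ U Q R Q₁ Q₂ with hk
  have ku : k u = U := by simp [hk, recolour]
  have kq : k q = Q := by simp [hk, recolour, uq]
  have kr : k r = R := by simp [hk, recolour, ur, n5.symm]
  have kq₁ : k q₁ = Q₁ := by simp [hk, recolour, uq₁, n6.symm, n8.symm]
  have kq₂ : k q₂ = Q₂ := by simp [hk, recolour, uq₂, n7.symm, n9.symm, n10.symm]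
  have ko : ∀ x, x ≠ u → x ≠ q → x ≠ r → x ≠ q₁ → x ≠ q₂ → k x = c x := by
    intro x h1 h2 h3 h4 h5
    simp [hk, recolour, h1, h2, h3, h4, h5]
  have kp : k p = c p := ko p up n1 n2 n3 n4
  have hku : ∀ y, σ.sign u y ≠ 0 → sp9Sign (k u) (k y) = σ.sign u y := by
    intro y hy
    rcases h.eq_or_eq y hy with rfl | rfl
    · rw [ku, hU₁, h.fst]
    · rw [ku, hU₂, h.snd]
  have step : ∀ x, x ≠ u → (∀ y, y ≠ u → σ.sign x y ≠ 0 → sp9Sign (k x) (k y) = h.contract.sign x y) →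
      ∀ y, σ.sign x y ≠ 0 → sp9Sign (k x) (k y) = σ.sign x y := by
    intro x hx hxy y hy
    by_cases hyu : y = u
    · subst hyu
      rw [σ.symm] at hy
      rw [sp9Sign_comm, σ.symm, hku x hy]
    · rw [hxy y hyu hy, h.sign_eq_contract h0 hx hyu hy]
  have nz : ∀ {x y}, x ≠ u → y ≠ u → σ.sign x y ≠ 0 → h.contract.sign x y ≠ 0 := by
    intro x y hx hy hxy
    rwa [h.sign_eq_contract h0 hx hy hxy]
  have hk' : σ.IsHom sp9Sign k := by
    refine IsHom.extend (T := {u, q, r, q₁, q₂}) sp9Sign_comm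
      ((isolate_isSubgraph σ _).isHom hc) ?_ ?_
    · intro x hx
      simp only [Set.mem_insert_iff, Set.mem_singleton_iff, not_or] at hx
      exact ko x hx.1 hx.2.1 hx.2.2.1 hx.2.2.2.1 hx.2.2.2.2
    · rintro x (rfl | rfl | rfl | rfl | rfl)
      · exact hku
      · refine step _ uq fun y hyu hy => ?_
        rcases N1 y (nz uq hyu hy) with rfl | rfl | rfl
        · rw [kq, kp, sp9Sign_comm, h.contract.symm, k7, hpq (by rwa [σ.symm])]
        · rw [kq, kq₁, k1, hqq₁ hy]
        · rw [kq, kq₂, k2, hqq₂ hy]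
      · refine step _ ur fun y hyu hy => ?_
        rcases N2 y (nz ur hyu hy) with rfl | rfl | rfl
        · rw [kr, kp, sp9Sign_comm, h.contract.symm, k8, hpr (by rwa [σ.symm])]
        · rw [kr, kq₁, k3, hrq₁ hy]
        · rw [kr, kq₂, k4, hrq₂ hy]
      · refine step _ uq₁ fun y hyu hy => ?_
        rcases N3 y (nz uq₁ hyu hy) with rfl | rfl | rfl
        · rw [kq₁, kq, sp9Sign_comm, h.contract.symm, k1, hqq₁ (by rwa [σ.symm])]
        · rw [kq₁, kr, sp9Sign_comm, h.contract.symm, k3, hrq₁ (by rwa [σ.symm])]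
        · rw [kq₁, kq₂, k5, hq₁q₂ hy]
      · refine step _ uq₂ fun y hyu hy => ?_
        rcases N4 y (nz uq₂ hyu hy) with rfl | rfl | rfl
        · rw [kq₂, kq, sp9Sign_comm, h.contract.symm, k2, hqq₂ (by rwa [σ.symm])]
        · rw [kq₂, kr, sp9Sign_comm, h.contract.symm, k4, hrq₂ (by rwa [σ.symm])]
        · rw [kq₂, kq₁, sp9Sign_comm, h.contract.symm, k5, hq₁q₂ (by rwa [σ.symm])]
  exact hU (by rw [← ku, ht k hk', ko w huw.symm w1 w2 w3 w4])

/-- The contracted edge is not an edge at the root of a rooted diamond. -/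
theorem root_false (h : σ.Fork u u₁ u₂ s) (hσ : σ.Subcubic) (h0 : σ.sign u₁ u₂ = 0)
    (huw : u ≠ w) (hw : σ.TwoNeighboursIn Set.univ w) (ht : σ.Tied u w)
    {c : V → Fin 3 × Fin 3} (hc : σ.IsHom sp9Sign c) {r q₁ q₂ : V} {a t : SignType}
    (hR : h.contract.RootedDiamond u₁ u₂ r q₁ q₂ a t) : False := by
  have hs : a = -s := hR.root_left.symm.trans h.contract_sign
  obtain ⟨R, h₁, Q, Q₁, h₂, h₃, Q₂, h₄, h₅, h₆, U, h₇, h₈, h₉⟩ :=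
    sp9_diamond_root (c u₁) (c w) a t hR.root_ne_zero hR.ne_zero
  obtain ⟨n1, n2, n3, n4, n5, n6, n7, n8, n9, n10⟩ := hR.ne
  refine h.recolour_false hσ h0 huw hw ht hc hR h₉ (fun h' => absurd h0 h') (fun _ => h₁)
    (fun _ => h₂) (fun _ => h₄) (fun _ => h₃) (fun _ => h₅) (fun _ => h₆) ?_ ?_
  · simp [recolour, h.ne_fst.symm, n1, n2, n3, n4, h₇, hs]
  · simp [recolour, h.ne_snd.symm, h₈, hs]

theorem side_false (h : σ.Fork u u₁ u₂ s) (hσ : σ.Subcubic) (h0 : σ.sign u₁ u₂ = 0)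
    (huw : u ≠ w) (hw : σ.TwoNeighboursIn Set.univ w) (ht : σ.Tied u w)
    {c : V → Fin 3 × Fin 3} (hc : σ.IsHom sp9Sign c) {p r q₂ : V} {a t : SignType}
    (hR : h.contract.RootedDiamond p u₁ r u₂ q₂ a t) : False := by
  have hs : t = -s := hR.left_fst.symm.trans h.contract_sign
  obtain ⟨Q, h₁, R, h₂, Q₁, h₃, Q₂, h₄, h₅, h₆, U, h₇, h₈, h₉⟩ :=
    sp9_diamond_side (c p) (c w) a t hR.root_ne_zero hR.ne_zero
  obtain ⟨n1, n2, n3, n4, n5, n6, n7, n8, n9, n10⟩ := hR.ne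
  refine h.recolour_false hσ h0 huw hw ht hc hR h₉ (fun _ => h₁) (fun _ => h₂)
    (fun h' => absurd h0 h') (fun _ => h₄) (fun _ => h₃) (fun _ => h₅) (fun _ => h₆) ?_ ?_
  · simp [recolour, h.ne_fst.symm, h₇, hs]
  · simp [recolour, h.ne_snd.symm, n6.symm, n8.symm, h₈, hs]

theorem middle_false (h : σ.Fork u u₁ u₂ s) (hσ : σ.Subcubic) (h0 : σ.sign u₁ u₂ = 0)
    (huw : u ≠ w) (hw : σ.TwoNeighboursIn Set.univ w) (ht : σ.Tied u w)
    {c : V → Fin 3 × Fin 3} (hc : σ.IsHom sp9Sign c) {p q r : V} {a t : SignType}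
    (hR : h.contract.RootedDiamond p q r u₁ u₂ a t) : False := by
  have hs : t = -s := hR.middle.symm.trans h.contract_sign
  obtain ⟨Q, h₁, R, h₂, Q₁, h₃, h₄, Q₂, h₅, h₆, U, h₇, h₈, h₉⟩ :=
    sp9_diamond_middle (c p) (c w) a t hR.root_ne_zero hR.ne_zero
  obtain ⟨n1, n2, n3, n4, n5, n6, n7, n8, n9, n10⟩ := hR.ne
  refine h.recolour_false hσ h0 huw hw ht hc hR h₉ (fun _ => h₁) (fun _ => h₂)
    (fun _ => h₃) (fun _ => h₅) (fun _ => h₄) (fun _ => h₆) (fun h' => absurd h0 h') ?_ ?_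
  · simp [recolour, h.ne_fst.symm, n6.symm, n8.symm, h₇, hs]
  · simp [recolour, h.ne_snd.symm, n7.symm, n9.symm, n10.symm, h₈, hs]

/-- A rooted diamond of the contracted graph must use the new edge. Up to symmetry that edge is at
the root, between an end and a middle vertex, or between the middle vertices; in each case `u` can
be recoloured while `w` keeps its colour. -/
theorem contract_diamondFree (h : σ.Fork u u₁ u₂ s) (hσ : σ.Good) (h0 : σ.sign u₁ u₂ = 0)
    (huw : u ≠ w) (hw : σ.TwoNeighboursIn Set.univ w) (ht : σ.Tied u w)
    {c : V → Fin 3 × Fin 3} (hc : σ.IsHom sp9Sign c) : h.contract.DiamondFree := by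
  intro p q r q₁ q₂ a t hR
  have h0' : σ.sign u₂ u₁ = 0 := by rwa [σ.symm]
  have root : ∀ {p q r q₁ q₂ a t}, h.contract.RootedDiamond p q r q₁ q₂ a t →
      ¬((p = u₁ ∧ q = u₂) ∨ (p = u₂ ∧ q = u₁)) := by
    rintro p q r q₁ q₂ a t hR (⟨rfl, rfl⟩ | ⟨rfl, rfl⟩)
    · exact h.root_false hσ.subcubic h0 huw hw ht hc hR
    · exact h.swap.root_false hσ.subcubic h0' huw hw ht hc (by rwa [h.contract_swap])
  have side : ∀ {p q r q₁ q₂ a t}, h.contract.RootedDiamond p q r q₁ q₂ a t →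
      ¬((q = u₁ ∧ q₁ = u₂) ∨ (q = u₂ ∧ q₁ = u₁)) := by
    rintro p q r q₁ q₂ a t hR (⟨rfl, rfl⟩ | ⟨rfl, rfl⟩)
    · exact h.side_false hσ.subcubic h0 huw hw ht hc hR
    · exact h.swap.side_false hσ.subcubic h0' huw hw ht hc (by rwa [h.contract_swap])
  have middle : ¬((q₁ = u₁ ∧ q₂ = u₂) ∨ (q₁ = u₂ ∧ q₂ = u₁)) := by
    rintro (⟨rfl, rfl⟩ | ⟨rfl, rfl⟩)
    · exact h.middle_false hσ.subcubic h0 huw hw ht hc hR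
    · exact h.swap.middle_false hσ.subcubic h0' huw hw ht hc (by rwa [h.contract_swap])
  have key : ∀ {x y z}, h.contract.sign x y = z → z ≠ 0 →
      ¬((x = u₁ ∧ y = u₂) ∨ (x = u₂ ∧ y = u₁)) → σ.sign x y = z := by
    intro x y z e hz hxy
    have e' := h.contract_sign_ne_zero (by rwa [e])
    rw [← e, h.contract_sign_of_ne (by tauto) (by tauto) hxy]
  have k0 := hR.ne_zero
  have k6 := hR.root_ne_zero
  exact hσ.diamondFree p q r q₁ q₂ a t
    ⟨⟨k0, key hR.left_fst k0 (side hR), key hR.left_snd k0 (side hR.swap_middle),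
      key hR.right_fst k0 (side hR.swap_ends), key hR.right_snd k0 (side hR.swap_ends.swap_middle),
      key hR.middle k0 middle⟩, k6, key hR.root_left k6 (root hR),
      key hR.root_right (by simpa) (root hR.swap_ends)⟩

end Fork

end SignGraph

/-! ### Tied vertices in a triangle -/

namespace SignGraph

variable {V : Type*} {σ : SignGraph V}

theorem exists_third (hσ : σ.Subcubic) (u u₁ u₂ : V) (hu : σ.sign u₁ u ≠ 0)
    (hu₂ : σ.sign u₁ u₂ ≠ 0) (hne : u ≠ u₂) :
    (∃ x, σ.sign u₁ x ≠ 0 ∧ x ≠ u ∧ x ≠ u₂ ∧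
      ∀ y, σ.sign u₁ y ≠ 0 → y = u ∨ y = u₂ ∨ y = x) ∨
    ∀ y, σ.sign u₁ y ≠ 0 → y = u ∨ y = u₂ := by
  by_cases h : ∃ x, σ.sign u₁ x ≠ 0 ∧ x ≠ u ∧ x ≠ u₂
  · obtain ⟨x, hx, hxu, hx₂⟩ := h
    exact .inl ⟨x, hx, hxu, hx₂, fun y hy =>
      hσ.eq_or_eq_or_eq hu hu₂ hx hne hxu.symm hx₂.symm hy⟩
  · refine .inr fun y hy => ?_
    by_contra h'
    exact h ⟨y, hy, by tauto⟩

namespace Fork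

variable {u u₁ u₂ w : V} {s : SignType}

/-- If the ends of a fork are adjacent, the triangle can be recoloured unless both further
neighbours of the triangle have the same colour. -/
theorem triangle_false (h : σ.Fork u u₁ u₂ s) (h12 : σ.sign u₁ u₂ = s) (huw : u ≠ w)
    (hw₁ : w ≠ u₁) (hw₂ : w ≠ u₂) (ht : σ.Tied u w) {c : V → Fin 3 × Fin 3}
    (hc : (σ.isolate {u, u₁, u₂}).IsHom sp9Sign c) {X₁ X₂ : Fin 3 × Fin 3} {a b : SignType}
    (ha : a ≠ 0) (hb : b ≠ 0)
    (h₁ : ∀ Z, sp9Sign Z X₁ = a → ∀ y, σ.sign u₁ y ≠ 0 → y ≠ u → y ≠ u₂ →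
      sp9Sign Z (c y) = σ.sign u₁ y)
    (h₂ : ∀ Z, sp9Sign Z X₂ = b → ∀ y, σ.sign u₂ y ≠ 0 → y ≠ u → y ≠ u₁ →
      sp9Sign Z (c y) = σ.sign u₂ y)
    (hX : ¬(X₁ = X₂ ∧ a = s ∧ b = s)) : False := by
  classical
  obtain ⟨U, hU, U₁, e₁, e₂, U₂, e₃, e₄, e₅⟩ :=
    sp9_exists_triangle X₁ X₂ (c w) a b s ha hb h.ne_zero hX
  set k : V → Fin 3 × Fin 3 :=
    fun x => if x = u then U else if x = u₁ then U₁ else if x = u₂ then U₂ else c x with hk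
  have ku : k u = U := by simp [hk]
  have k₁ : k u₁ = U₁ := by simp [hk, h.ne_fst.symm]
  have k₂ : k u₂ = U₂ := by simp [hk, h.ne_snd.symm, h.ne.symm]
  have ko : ∀ x, x ≠ u → x ≠ u₁ → x ≠ u₂ → k x = c x := by
    intro x i1 i2 i3
    simp [hk, i1, i2, i3]
  have hkh : σ.IsHom sp9Sign k := by
    refine IsHom.extend (T := {u, u₁, u₂}) sp9Sign_comm hc ?_ ?_
    · intro x hx
      simp only [Set.mem_insert_iff, Set.mem_singleton_iff, not_or] at hx
      exact ko x hx.1 hx.2.1 hx.2.2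
    · rintro x (rfl | rfl | rfl) y hy
      · rcases h.eq_or_eq y hy with rfl | rfl
        · rw [ku, k₁, e₂, h.fst]
        · rw [ku, k₂, e₅, h.snd]
      · by_cases hyu : y = u
        · rw [hyu, ku, k₁, sp9Sign_comm, e₂, σ.symm, h.fst]
        by_cases hy₂ : y = u₂
        · rw [hy₂, k₁, k₂, e₄, h12]
        · rw [k₁, ko y hyu (ne_of_sign hy).symm hy₂, h₁ U₁ e₁ y hy hyu hy₂]
      · by_cases hyu : y = u
        · rw [hyu, ku, k₂, sp9Sign_comm, e₅, σ.symm, h.snd]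
        by_cases hy₁ : y = u₁
        · rw [hy₁, k₁, k₂, sp9Sign_comm, e₄, σ.symm, h12]
        · rw [k₂, ko y hyu hy₁ (ne_of_sign hy).symm, h₂ U₂ e₃ y hy hyu hy₁]
  exact hU (by rw [← ku, ht k hkh, ko w huw.symm hw₁ hw₂])

/-- In a tied triangle, the further neighbours exist, have the sign of the triangle, and are
coloured the same. -/
theorem triangle_thirds (h : σ.Fork u u₁ u₂ s) (hσ : σ.Subcubic) (h12 : σ.sign u₁ u₂ = s)
    (huw : u ≠ w) (hw₁ : w ≠ u₁) (hw₂ : w ≠ u₂) (ht : σ.Tied u w) {c₀ : V → Fin 3 × Fin 3}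
    (hc₀ : σ.IsHom sp9Sign c₀) :
    ∃ x₁ x₂, (σ.sign u₁ x₁ = s ∧ x₁ ≠ u ∧ x₁ ≠ u₂ ∧
        ∀ y, σ.sign u₁ y ≠ 0 → y = u ∨ y = u₂ ∨ y = x₁) ∧
      (σ.sign u₂ x₂ = s ∧ x₂ ≠ u ∧ x₂ ≠ u₁ ∧ ∀ y, σ.sign u₂ y ≠ 0 → y = u ∨ y = u₁ ∨ y = x₂) ∧
      ∀ c : V → Fin 3 × Fin 3, (σ.isolate {u, u₁, u₂}).IsHom sp9Sign c → c x₁ = c x₂ := by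
  have hs := h.ne_zero
  have hs' : -s ≠ 0 := by simpa
  have hss := signType_ne_neg hs
  have hi := (isolate_isSubgraph σ {u, u₁, u₂}).isHom hc₀
  -- A missing third neighbour is replaced by a fictitious one joined with sign `-s`, which rules
  -- out the exceptional case of `triangle_false`.
  have vac : ∀ {c : V → Fin 3 × Fin 3} {v v' : V},
      (∀ y, σ.sign v y ≠ 0 → y = u ∨ y = v') → ∀ X, ∀ Z, sp9Sign Z X = -s →
      ∀ y, σ.sign v y ≠ 0 → y ≠ u → y ≠ v' → sp9Sign Z (c y) = σ.sign v y := by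
    intro c v v' hv X Z _ y hy h1 h2
    exact absurd (hv y hy) (by tauto)
  have third : ∀ {c : V → Fin 3 × Fin 3} {v v' x : V},
      (∀ y, σ.sign v y ≠ 0 → y = u ∨ y = v' ∨ y = x) → ∀ Z, sp9Sign Z (c x) = σ.sign v x →
      ∀ y, σ.sign v y ≠ 0 → y ≠ u → y ≠ v' → sp9Sign Z (c y) = σ.sign v y := by
    intro c v v' x hv Z hZ y hy h1 h2
    obtain rfl : y = x := by have := hv y hy; tauto
    exact hZ
  rcases exists_third hσ u u₁ u₂ h.sign_fst_ne_zero (by rwa [h12]) h.ne_snd with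
    ⟨x₁, hx₁, hx₁u, hx₁₂, N₁⟩ | N₁
  · rcases exists_third hσ u u₂ u₁ h.swap.sign_fst_ne_zero (by rwa [σ.symm, h12]) h.ne_fst with
      ⟨x₂, hx₂, hx₂u, hx₂₁, N₂⟩ | N₂
    · have key : ∀ c : V → Fin 3 × Fin 3, (σ.isolate {u, u₁, u₂}).IsHom sp9Sign c →
          c x₁ = c x₂ ∧ σ.sign u₁ x₁ = s ∧ σ.sign u₂ x₂ = s := fun c hc => by
        by_contra hX
        exact h.triangle_false h12 huw hw₁ hw₂ ht hc hx₁ hx₂ (third N₁) (third N₂) hX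
      exact ⟨x₁, x₂, ⟨(key c₀ hi).2.1, hx₁u, hx₁₂, N₁⟩, ⟨(key c₀ hi).2.2, hx₂u, hx₂₁, N₂⟩,
        fun c hc => (key c hc).1⟩
    · exact (h.triangle_false h12 huw hw₁ hw₂ ht hi hx₁ hs' (third N₁) (vac N₂ 0)
        fun e => hss e.2.2.symm).elim
  · rcases exists_third hσ u u₂ u₁ h.swap.sign_fst_ne_zero (by rwa [σ.symm, h12]) h.ne_fst with
      ⟨x₂, hx₂, hx₂u, hx₂₁, N₂⟩ | N₂
    · exact (h.triangle_false h12 huw hw₁ hw₂ ht hi hs' hx₂ (vac N₁ 0) (third N₂)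
        fun e => hss e.2.1.symm).elim
    · exact (h.triangle_false h12 huw hw₁ hw₂ ht hi hs' hs' (vac N₁ 0) (vac N₂ 0)
        fun e => hss e.2.1.symm).elim

/-- The case of a diamond with ends `u` and `x`. -/
theorem diamond_false (h : σ.Fork u u₁ u₂ s) (hσ : σ.Subcubic) (h12 : σ.sign u₁ u₂ = s)
    (huw : u ≠ w) (hw₁ : w ≠ u₁) (hw₂ : w ≠ u₂) (ht : σ.Tied u w) {c : V → Fin 3 × Fin 3}
    (hc : σ.IsHom sp9Sign c) {x : V} (hxw : x ≠ w) (hx₁ : σ.sign u₁ x = s)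
    (hx₂ : σ.sign u₂ x = s) (hxu : x ≠ u) (N₁ : ∀ y, σ.sign u₁ y ≠ 0 → y = u ∨ y = u₂ ∨ y = x)
    (N₂ : ∀ y, σ.sign u₂ y ≠ 0 → y = u ∨ y = u₁ ∨ y = x) : False := by
  classical
  have hs := h.ne_zero
  have hxu₁ : u₁ ≠ x := ne_of_sign (by rwa [hx₁])
  have hxu₂ : u₂ ≠ x := ne_of_sign (by rwa [hx₂])
  -- Besides `u₁` and `u₂`, `x` has at most one neighbour, so it has a colour other than that of
  -- `w`. Giving this colour to `u` as well, the diamond folds onto a monochromatic triangle.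
  obtain ⟨X, hXw, hX⟩ : ∃ X, X ≠ c w ∧ ∀ y, σ.sign x y ≠ 0 → y ≠ u₁ → y ≠ u₂ →
      sp9Sign X (c y) = σ.sign x y := by
    rcases exists_third hσ u₁ x u₂ (by rwa [σ.symm, hx₁]) (by rwa [σ.symm, hx₂]) h.ne with
      ⟨y, hy, hy₁, hy₂, N⟩ | N
    · obtain ⟨X, hX, hXw⟩ := sp9_exists_one (c y) (c w) _ hy
      refine ⟨X, hXw, fun z hz hz₁ hz₂ => ?_⟩
      obtain rfl : z = y := by have := N z hz; tauto
      exact hX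
    · obtain ⟨X, -, hXw⟩ := sp9_exists_one 0 (c w) 1 (by decide)
      exact ⟨X, hXw, fun z hz hz₁ hz₂ => absurd (N z hz) (by tauto)⟩
  obtain ⟨Z₁, e₁, Z₂, e₂, e₃⟩ := sp9_exists_line X s hs
  set k : V → Fin 3 × Fin 3 := fun y => if y = u then X else if y = x then X else
    if y = u₁ then Z₁ else if y = u₂ then Z₂ else c y with hk
  have ku : k u = X := by simp [hk]
  have kx : k x = X := by simp [hk]
  have k₁ : k u₁ = Z₁ := by simp [hk, h.ne_fst.symm, hxu₁]
  have k₂ : k u₂ = Z₂ := by simp [hk, h.ne_snd.symm, hxu₂, h.ne.symm]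
  have ko : ∀ y, y ≠ u → y ≠ x → y ≠ u₁ → y ≠ u₂ → k y = c y := by
    intro y i1 i2 i3 i4
    simp [hk, i1, i2, i3, i4]
  have hkh : σ.IsHom sp9Sign k := by
    refine IsHom.extend (T := {u, x, u₁, u₂}) sp9Sign_comm
      ((isolate_isSubgraph σ _).isHom hc) ?_ ?_
    · intro y hy
      simp only [Set.mem_insert_iff, Set.mem_singleton_iff, not_or] at hy
      exact ko y hy.1 hy.2.1 hy.2.2.1 hy.2.2.2
    · rintro y (rfl | rfl | rfl | rfl) z hz
      · rcases h.eq_or_eq z hz with rfl | rfl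
        · rw [ku, k₁, sp9Sign_comm, e₁, h.fst]
        · rw [ku, k₂, sp9Sign_comm, e₂, h.snd]
      · by_cases hz₁ : z = u₁
        · rw [hz₁, kx, k₁, sp9Sign_comm, e₁, σ.symm, hx₁]
        by_cases hz₂ : z = u₂
        · rw [hz₂, kx, k₂, sp9Sign_comm, e₂, σ.symm, hx₂]
        have hzu : z ≠ u := by
          rintro rfl
          rcases h.eq_or_eq y (by rwa [σ.symm]) with e | e
          exacts [hxu₁ e.symm, hxu₂ e.symm]
        rw [kx, ko z hzu (ne_of_sign hz).symm hz₁ hz₂, hX z hz hz₁ hz₂]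
      · rcases N₁ z hz with rfl | rfl | rfl
        · rw [ku, k₁, e₁, σ.symm, h.fst]
        · rw [k₁, k₂, e₃, h12]
        · rw [k₁, kx, e₁, hx₁]
      · rcases N₂ z hz with rfl | rfl | rfl
        · rw [ku, k₂, e₂, σ.symm, h.snd]
        · rw [k₁, k₂, sp9Sign_comm, e₃, σ.symm, h12]
        · rw [k₂, kx, e₂, hx₂]
  exact hXw (by rw [← ku, ht k hkh, ko w huw.symm hxw.symm hw₁ hw₂])

end Fork

/-! ### Reattaching a tied triangle -/

/-- Delete all edges at `u`, `u₁` and `u₂`, and join `u` to `x₁` and `x₂` with different signs. -/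
noncomputable def reattach (σ : SignGraph V) (u u₁ u₂ : V) {x₁ x₂ : V} (h₁ : u ≠ x₁)
    (h₂ : u ≠ x₂) : SignGraph V :=
  ((σ.isolate {u, u₁, u₂}).setSign u x₁ 1 h₁).setSign u x₂ (-1) h₂

section reattach

variable {u u₁ u₂ x₁ x₂ : V} {h₁ : u ≠ x₁} {h₂ : u ≠ x₂}

theorem reattach_sign_fst (hne : x₁ ≠ x₂) : (σ.reattach u u₁ u₂ h₁ h₂).sign u x₁ = 1 := by
  rw [reattach, setSign_sign_of_ne, setSign_sign]
  rintro (⟨-, e⟩ | ⟨e, -⟩)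
  exacts [hne e, h₂ e]

theorem reattach_sign_snd : (σ.reattach u u₁ u₂ h₁ h₂).sign u x₂ = -1 :=
  setSign_sign

theorem reattach_sign_of_ne {x y : V} (hx : x ≠ u) (hy : y ≠ u) :
    (σ.reattach u u₁ u₂ h₁ h₂).sign x y = (σ.isolate {u, u₁, u₂}).sign x y := by
  rw [reattach, setSign_sign_of_ne (by tauto), setSign_sign_of_ne (by tauto)]

theorem reattach_sign_left {y : V} (h : (σ.reattach u u₁ u₂ h₁ h₂).sign u y ≠ 0) :
    y = x₁ ∨ y = x₂ := by
  by_contra! hy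
  rw [reattach, setSign_sign_of_ne (by tauto), setSign_sign_of_ne (by tauto),
    isolate_sign_left (by simp)] at h
  exact h rfl

theorem isolate_isSubgraph_reattach :
    (σ.isolate {u, u₁, u₂}).IsSubgraph (σ.reattach u u₁ u₂ h₁ h₂) := by
  intro x y hxy
  obtain ⟨hx, hy, -⟩ := isolate_sign_ne_zero.1 hxy
  exact (reattach_sign_of_ne (fun e => hx (.inl e)) (fun e => hy (.inl e))).symm

theorem reattach_sign_ne_zero {x y : V} (h : (σ.reattach u u₁ u₂ h₁ h₂).sign x y ≠ 0)
    (hx : x ≠ u) : (y = u ∧ (x = x₁ ∨ x = x₂)) ∨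
      (x ≠ u₁ ∧ x ≠ u₂ ∧ y ≠ u ∧ y ≠ u₁ ∧ y ≠ u₂ ∧ σ.sign x y ≠ 0) := by
  by_cases hy : y = u
  · subst hy
    rw [SignGraph.symm] at h
    exact .inl ⟨rfl, reattach_sign_left h⟩
  · rw [reattach_sign_of_ne hx hy, isolate_sign_ne_zero] at h
    simp only [Set.mem_insert_iff, Set.mem_singleton_iff, not_or] at h
    tauto

theorem reattach_exchange (e₁ : σ.sign x₁ u₁ ≠ 0) (e₂ : σ.sign x₂ u₂ ≠ 0) {x : V} (hx : x ≠ u) :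
    (∀ y, (σ.reattach u u₁ u₂ h₁ h₂).sign x y ≠ 0 → σ.sign x y ≠ 0) ∨
      ∃ n z, σ.sign x n ≠ 0 ∧
        ∀ y, (σ.reattach u u₁ u₂ h₁ h₂).sign x y ≠ 0 → y = z ∨ (σ.sign x y ≠ 0 ∧ y ≠ n) := by
  by_cases hx₁ : x = x₁
  · subst hx₁
    refine .inr ⟨u₁, u, e₁, fun y hy => ?_⟩
    have := reattach_sign_ne_zero hy hx
    tauto
  by_cases hx₂ : x = x₂
  · subst hx₂
    refine .inr ⟨u₂, u, e₂, fun y hy => ?_⟩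
    have := reattach_sign_ne_zero hy hx
    tauto
  · refine .inl fun y hy => ?_
    have := reattach_sign_ne_zero hy hx
    tauto

theorem reattach_subcubic (hσ : σ.Subcubic) (e₁ : σ.sign x₁ u₁ ≠ 0) (e₂ : σ.sign x₂ u₂ ≠ 0) :
    (σ.reattach u u₁ u₂ h₁ h₂).Subcubic := by
  intro x
  by_cases hx : x = u
  · subst hx
    exact ⟨x₁, x₂, x₂, fun y hy => (reattach_sign_left hy).imp id .inl⟩
  rcases reattach_exchange e₁ e₂ hx with h | ⟨n, z, hn, h⟩
  · obtain ⟨a, b, c, habc⟩ := hσ x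
    exact ⟨a, b, c, fun y hy => habc y (h y hy)⟩
  · exact exists_three_of_exchange (hσ x) hn h

theorem reattach_twoNeighboursIn (e₁ : σ.sign x₁ u₁ ≠ 0) (e₂ : σ.sign x₂ u₂ ≠ 0) {w : V}
    (hw : σ.TwoNeighboursIn Set.univ w) :
    (σ.reattach u u₁ u₂ h₁ h₂).TwoNeighboursIn Set.univ w := by
  by_cases hx : w = u
  · subst hx
    exact ⟨x₁, x₂, fun y _ hy => reattach_sign_left hy⟩
  obtain ⟨a, b, hab⟩ := hw
  rcases reattach_exchange e₁ e₂ hx with h | ⟨n, z, hn, h⟩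
  · exact ⟨a, b, fun y hy hxy => hab y hy (h y hxy)⟩
  · obtain ⟨a, b, hab⟩ := exists_two_of_exchange ⟨a, b, fun y => hab y trivial⟩ hn h
    exact ⟨a, b, fun y _ => hab y⟩

theorem reattach_degenerate (hσ : σ.Degenerate) : (σ.reattach u u₁ u₂ h₁ h₂).Degenerate := by
  intro S hS
  by_cases hu : u ∈ S
  · exact ⟨u, hu, x₁, x₂, fun y _ hy => reattach_sign_left hy⟩
  · obtain ⟨x, hx, a, b, hab⟩ := hσ S hS
    refine ⟨x, hx, a, b, fun y hy hxy => hab y hy ?_⟩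
    have hxu : x ≠ u := fun e => hu (e ▸ hx)
    have hyu : y ≠ u := fun e => hu (e ▸ hy)
    have := reattach_sign_ne_zero hxy hxu
    tauto

end reattach

namespace Fork

variable {u u₁ u₂ w : V} {s : SignType}

/-- Having only two neighbours, `u` can occur in a rooted diamond only as its root. Then the ends
are `x₁` and `x₂`, and the diamond together with the triangle is a union of components of `σ` that
avoids `w`. -/
theorem reattach_diamondFree (h : σ.Fork u u₁ u₂ s) (hσ : σ.Good) (huw : u ≠ w)
    (hw : σ.TwoNeighboursIn Set.univ w)
    (hw₁ : w ≠ u₁) (hw₂ : w ≠ u₂) (ht : σ.Tied u w) {c : V → Fin 3 × Fin 3}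
    (hc : σ.IsHom sp9Sign c) {x₁ x₂ : V} (h₁ : u ≠ x₁) (h₂ : u ≠ x₂)
    (e₁ : σ.sign u₁ x₁ ≠ 0) (e₂ : σ.sign u₂ x₂ ≠ 0)
    (N₁ : ∀ y, σ.sign u₁ y ≠ 0 → y = u ∨ y = u₂ ∨ y = x₁)
    (N₂ : ∀ y, σ.sign u₂ y ≠ 0 → y = u ∨ y = u₁ ∨ y = x₂) :
    (σ.reattach u u₁ u₂ h₁ h₂).DiamondFree := by
  intro p q r q₁ q₂ a t hR
  rw [σ.symm] at e₁ e₂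
  have hu : (σ.reattach u u₁ u₂ h₁ h₂).TwoNeighboursIn Set.univ u :=
    ⟨x₁, x₂, fun y _ hy => reattach_sign_left hy⟩
  obtain ⟨uq, ur, uq₁, uq₂⟩ := hR.ne_of_twoNeighboursIn hu
  obtain ⟨wq, wr, wq₁, wq₂⟩ :=
    hR.ne_of_twoNeighboursIn (reattach_twoNeighboursIn (h₁ := h₁) (h₂ := h₂) e₁ e₂ hw)
  obtain ⟨M1, M2, M3, M4⟩ := hR.neighbours (reattach_subcubic hσ.subcubic e₁ e₂)
  have hqr := hR.ne.2.2.2.2.1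
  by_cases hp : p = u
  · subst hp
    have hq : q = x₁ ∨ q = x₂ := reattach_sign_left (by rw [hR.root_left]; exact hR.root_ne_zero)
    have hr : r = x₁ ∨ r = x₂ := reattach_sign_left (by
      rw [hR.root_right]; simpa using hR.root_ne_zero)
    have step : ∀ {x y}, x ≠ p → σ.sign x y ≠ 0 → x ≠ u₁ → x ≠ u₂ →
        (y = p ∨ y = u₁ ∨ y = u₂) ∨ (σ.reattach p u₁ u₂ h₁ h₂).sign x y ≠ 0 := by
      intro x y hx hxy hx₁ hx₂
      by_cases hy : y = p ∨ y = u₁ ∨ y = u₂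
      · exact .inl hy
      · refine .inr (isolate_isSubgraph_reattach.ne_zero (isolate_sign_ne_zero.2 ⟨?_, hy, hxy⟩))
        rintro (e | e | e)
        exacts [hx e, hx₁ e, hx₂ e]
    have hx₁ : x₁ = q ∨ x₁ = r := by
      rcases hq with e | e <;> rcases hr with e' | e'
      exacts [.inl e.symm, .inl e.symm, .inr e'.symm, absurd (e.trans e'.symm) hqr]
    have hx₂ : x₂ = q ∨ x₂ = r := by
      rcases hq with e | e <;> rcases hr with e' | e'
      exacts [absurd (e.trans e'.symm) hqr, .inr e'.symm, .inl e.symm, .inl e.symm]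
    have in_base : ∀ {y}, y = p ∨ y = u₁ ∨ y = u₂ → y ∈ ({p, u₁, u₂, q, r, q₁, q₂} : Set V) := by
      rintro y (rfl | rfl | rfl) <;> simp
    have in_ends : ∀ {y}, y = q ∨ y = r → y ∈ ({p, u₁, u₂, q, r, q₁, q₂} : Set V) := by
      rintro y (rfl | rfl) <;> simp
    have in_mid : ∀ {y}, y = p ∨ y = q₁ ∨ y = q₂ → y ∈ ({p, u₁, u₂, q, r, q₁, q₂} : Set V) := by
      rintro y (rfl | rfl | rfl) <;> simp
    refine ht.false_of_closed hc (T := {p, u₁, u₂, q, r, q₁, q₂}) ?_ (by simp) ?_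
    · intro x hx y hy
      by_cases hxp : x = p
      · subst hxp
        exact in_base (.inr (h.eq_or_eq y hy))
      by_cases hxu₁ : x = u₁
      · subst hxu₁
        rcases N₁ y hy with e | e | e
        exacts [in_base (.inl e), in_base (.inr (.inr e)), in_ends (e ▸ hx₁)]
      by_cases hxu₂ : x = u₂
      · subst hxu₂
        rcases N₂ y hy with e | e | e
        exacts [in_base (.inl e), in_base (.inr (.inl e)), in_ends (e ▸ hx₂)]
      rcases step hxp hy hxu₁ hxu₂ with hy' | hy'
      · exact in_base hy'
      · rcases ((hx.resolve_left hxp).resolve_left hxu₁).resolve_left hxu₂ with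
          rfl | rfl | rfl | rfl
        · exact in_mid (M1 y hy')
        · exact in_mid (M2 y hy')
        · rcases M3 y hy' with e | e | e
          exacts [in_ends (.inl e), in_ends (.inr e), in_mid (.inr (.inr e))]
        · rcases M4 y hy' with e | e | e
          exacts [in_ends (.inl e), in_ends (.inr e), in_mid (.inr (.inl e))]
    · simp only [Set.mem_insert_iff, Set.mem_singleton_iff, not_or]
      exact ⟨huw.symm, hw₁, hw₂, wq, wr, wq₁, wq₂⟩
  · have key : ∀ {x y z}, (σ.reattach u u₁ u₂ h₁ h₂).sign x y = z → z ≠ 0 → x ≠ u → y ≠ u →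
        σ.sign x y = z := by
      intro x y z e hz hx hy
      rw [reattach_sign_of_ne hx hy] at e
      rw [← isolate_isSubgraph σ _ x y (by rwa [e]), e]
    have k0 := hR.ne_zero
    have k6 := hR.root_ne_zero
    exact hσ.diamondFree p q r q₁ q₂ a t
      ⟨⟨k0, key hR.left_fst k0 uq.symm uq₁.symm, key hR.left_snd k0 uq.symm uq₂.symm,
        key hR.right_fst k0 ur.symm uq₁.symm, key hR.right_snd k0 ur.symm uq₂.symm,
        key hR.middle k0 uq₁.symm uq₂.symm⟩, k6, key hR.root_left k6 hp uq.symm,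
        key hR.root_right (by simpa) hp ur.symm⟩

theorem reattach_support_subset {x₁ x₂ : V} {h₁ : u ≠ x₁} {h₂ : u ≠ x₂} (h : σ.Fork u u₁ u₂ s)
    (e₁ : σ.sign x₁ u₁ ≠ 0) (e₂ : σ.sign x₂ u₂ ≠ 0) :
    (σ.reattach u u₁ u₂ h₁ h₂).support ⊆ σ.support := by
  rintro x ⟨y, hy⟩
  by_cases hx : x = u
  · subst hx
    exact ⟨u₁, by rw [h.fst]; exact h.ne_zero⟩
  · rcases reattach_sign_ne_zero hy hx with ⟨-, rfl | rfl⟩ | h'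
    exacts [⟨u₁, e₁⟩, ⟨u₂, e₂⟩, ⟨y, h'.2.2.2.2.2⟩]

end Fork

/-! ### Good signed graphs map to `SP₉` -/

/-- Two vertices of degree at most two can be coloured differently, unless they are the ends of a
monochromatic diamond. -/
theorem Good.exists_isHom_ne (hσ : σ.Good) {u w : V} (huw : u ≠ w)
    (hu : σ.TwoNeighboursIn Set.univ u) (hw : σ.TwoNeighboursIn Set.univ w)
    (hd : ∀ q₁ q₂ t, ¬ σ.Diamond u w q₁ q₂ t)
    (IH : ∀ σ' : SignGraph V, σ'.Good → σ'.support ⊆ σ.support →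
      ∃ c : V → Fin 3 × Fin 3, σ'.IsHom sp9Sign c) :
    ∃ c : V → Fin 3 × Fin 3, σ.IsHom sp9Sign c ∧ c u ≠ c w := by
  by_contra! ht
  replace ht : σ.Tied u w := ht
  obtain ⟨c₀, hc₀⟩ := IH σ hσ subset_rfl
  obtain ⟨u₁, u₂, s, h, hf⟩ := ht.exists_fork huw hu hc₀
  have hs := h.ne_zero
  have hss := signType_ne_neg hs
  by_cases h0 : σ.sign u₁ u₂ = 0
  -- A colouring of the contracted graph gives `u₁ u₂` the sign `-s`, whereas being tied forces `s`.
  · obtain ⟨c, hc⟩ := IH h.contract ⟨h.contract_subcubic hσ.subcubic,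
      h.contract_degenerate hσ.subcubic hσ.degenerate h0 huw hw ht hc₀,
      h.contract_diamondFree hσ h0 huw hw ht hc₀⟩ h.contract_support_subset
    have e := hf c ((h.isolate_isSubgraph_contract h0).isHom hc)
    rw [hc u₁ u₂ (by rw [h.contract_sign]; simpa), h.contract_sign] at e
    exact hss e.symm
  have h12 : σ.sign u₁ u₂ = s := by
    rw [← hc₀ u₁ u₂ h0, hf c₀ ((isolate_isSubgraph σ _).isHom hc₀)]
  have hw₁ : w ≠ u₁ := by
    rintro rfl
    exact hc₀.sign_ne (by rwa [h.fst]) (ht c₀ hc₀)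
  have hw₂ : w ≠ u₂ := by
    rintro rfl
    exact hc₀.sign_ne (by rwa [h.snd]) (ht c₀ hc₀)
  obtain ⟨x₁, x₂, ⟨e₁, hx₁, -, N₁⟩, ⟨e₂, hx₂, -, N₂⟩, hx⟩ :=
    h.triangle_thirds hσ.subcubic h12 huw hw₁ hw₂ ht hc₀
  by_cases hne : x₁ = x₂
  · subst hne
    by_cases hxw : x₁ = w
    · subst hxw
      exact hd u₁ u₂ s ⟨hs, h.fst, h.snd, by rwa [σ.symm], by rwa [σ.symm], h12⟩
    · exact h.diamond_false hσ.subcubic h12 huw hw₁ hw₂ ht hc₀ hxw e₁ e₂ hx₁ N₁ N₂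
  · have f₁ : σ.sign x₁ u₁ ≠ 0 := by rwa [σ.symm, e₁]
    have f₂ : σ.sign x₂ u₂ ≠ 0 := by rwa [σ.symm, e₂]
    -- In the reattached graph `u` sees `x₁` and `x₂` with different signs, so their colours differ,
    -- against `hx`.
    obtain ⟨c, hc⟩ := IH (σ.reattach u u₁ u₂ hx₁.symm hx₂.symm)
      ⟨reattach_subcubic hσ.subcubic f₁ f₂, reattach_degenerate hσ.degenerate,
        h.reattach_diamondFree hσ huw hw hw₁ hw₂ ht hc₀ hx₁.symm hx₂.symm (by rwa [σ.symm])
          (by rwa [σ.symm]) N₁ N₂⟩ (h.reattach_support_subset f₁ f₂)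
    have g := hx c (isolate_isSubgraph_reattach.isHom hc)
    have g₁ := hc u x₁ (by rw [reattach_sign_fst hne]; decide)
    have g₂ := hc u x₂ (by rw [reattach_sign_snd]; decide)
    rw [reattach_sign_fst hne] at g₁
    rw [reattach_sign_snd, ← g, g₁] at g₂
    exact absurd g₂ (by decide)

theorem Subcubic.twoNeighboursIn_isolate (hσ : σ.Subcubic) {v x : V} (h : σ.sign x v ≠ 0) :
    (σ.isolate {v}).TwoNeighboursIn Set.univ x := by
  obtain ⟨a, b, c, habc⟩ := hσ x
  have key : ∀ y, (σ.isolate {v}).sign x y ≠ 0 → y ≠ v ∧ (y = a ∨ y = b ∨ y = c) := fun y hy =>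
    have := isolate_sign_ne_zero.1 hy
    ⟨this.2.1, habc y this.2.2⟩
  rcases habc v h with rfl | rfl | rfl
  · exact ⟨b, c, fun y _ hy => by have := key y hy; tauto⟩
  · exact ⟨a, c, fun y _ hy => by have := key y hy; tauto⟩
  · exact ⟨a, b, fun y _ hy => by have := key y hy; tauto⟩

/-- A vertex of the support with at most two neighbours. -/
theorem Degenerate.exists_mem_support (hσ : σ.Degenerate) (h : σ.support.Nonempty) :
    ∃ v ∈ σ.support, ∃ a b, ∀ y, σ.sign v y ≠ 0 → y = a ∨ y = b := by
  obtain ⟨v, hv, a, b, hab⟩ := hσ _ h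
  exact ⟨v, hv, a, b, fun y hy => hab y ⟨v, by rwa [σ.symm]⟩ hy⟩

/-- Good signed graphs map to `SP₉`. -/
theorem Good.exists_isHom [Finite V] (hσ : σ.Good) :
    ∃ c : V → Fin 3 × Fin 3, σ.IsHom sp9Sign c := by
  induction hn : σ.support.ncard using Nat.strong_induction_on generalizing σ with
  | _ n ih =>
  subst hn
  by_cases h : σ.support.Nonempty
  swap
  · exact ⟨fun _ => 0, fun x y hxy => absurd ⟨x, y, hxy⟩ h⟩
  obtain ⟨v, hv, a, b, hab⟩ := hσ.degenerate.exists_mem_support h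
  have hsub := isolate_isSubgraph σ {v}
  have hlt := ncard_support_isolate_lt hv (Set.mem_singleton v)
  -- Only the support is compared, so the induction also covers modified graphs with new edges.
  have IH : ∀ σ' : SignGraph V, σ'.Good → σ'.support ⊆ (σ.isolate {v}).support →
      ∃ c : V → Fin 3 × Fin 3, σ'.IsHom sp9Sign c := fun σ' h₁ h₂ =>
    ih _ ((Set.ncard_le_ncard h₂ (Set.toFinite _)).trans_lt hlt) h₁ rfl
  obtain ⟨c, hc⟩ := IH _ (hsub.good hσ) subset_rfl
  have finish : ∀ c : V → Fin 3 × Fin 3, (σ.isolate {v}).IsHom sp9Sign c →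
      (∃ z, ∀ y, σ.sign v y ≠ 0 → sp9Sign z (c y) = σ.sign v y) →
      ∃ c : V → Fin 3 × Fin 3, σ.IsHom sp9Sign c := fun c hc ⟨z, hz⟩ =>
    ⟨_, hc.extend_one sp9Sign_comm hz⟩
  have one : ∀ x, (∀ y, σ.sign v y ≠ 0 → y = x) →
      ∃ c : V → Fin 3 × Fin 3, σ.IsHom sp9Sign c := by
    intro x hx
    obtain ⟨y, hy⟩ := hv
    obtain rfl := hx y hy
    obtain ⟨z, hz, -⟩ := sp9_exists_one (c y) 0 _ hy
    exact finish c hc ⟨z, fun y' hy' => by rw [hx y' hy', hz]⟩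
  by_cases ha : σ.sign v a = 0
  · exact one b fun y hy => (hab y hy).resolve_left fun e => hy (e ▸ ha)
  by_cases hb : σ.sign v b = 0
  · exact one a fun y hy => (hab y hy).resolve_right fun e => hy (e ▸ hb)
  have two : ∀ c : V → Fin 3 × Fin 3, (σ.isolate {v}).IsHom sp9Sign c →
      (c a = c b → σ.sign v a = σ.sign v b) → ∃ c : V → Fin 3 × Fin 3, σ.IsHom sp9Sign c := by
    intro c hc h
    obtain ⟨z, h₁, h₂⟩ := sp9_exists_two (c a) (c b) _ _ ha hb h
    refine finish c hc ⟨z, fun y hy => ?_⟩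
    rcases hab y hy with rfl | rfl
    exacts [h₁, h₂]
  by_cases hs : σ.sign v a = σ.sign v b
  · exact two c hc fun _ => hs
  have hne : a ≠ b := by
    rintro rfl
    exact hs rfl
  obtain ⟨c, hc, hcne⟩ := (hsub.good hσ).exists_isHom_ne hne
    (hσ.subcubic.twoNeighboursIn_isolate (by rwa [σ.symm]))
    (hσ.subcubic.twoNeighboursIn_isolate (by rwa [σ.symm]))
    -- A monochromatic diamond with ends `a` and `b` would be rooted at `v`.
    (fun q₁ q₂ t hD => hσ.diamondFree v a b q₁ q₂ (σ.sign v a) t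
      ⟨hsub.diamond hD, ha, rfl,
        (signType_eq_or_eq_neg ha hb).resolve_left fun e => hs e.symm⟩) IH
  exact two c hc fun e => absurd e hcne

end SignGraph

/-! ### Using the tenth vertex -/

namespace SignGraph

variable {V : Type*} {σ : SignGraph V}

/-- With the help of a new vertex, rooted diamonds can be coloured. -/
theorem RootedDiamond.exists_isHom (hσ : σ.Subcubic) {p q r q₁ q₂ : V} {a t : SignType}
    (h : σ.RootedDiamond p q r q₁ q₂ a t) {k : V → Option (Fin 3 × Fin 3)}
    (hk : (σ.isolate {q, r, q₁, q₂}).IsHom (extSign diamondSign) k) :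
    ∃ k' : V → Option (Fin 3 × Fin 3), σ.IsHom (extSign diamondSign) k' := by
  classical
  obtain ⟨n1, n2, n3, n4, n5, n6, n7, n8, n9, n10⟩ := h.ne
  obtain ⟨N1, N2, N3, N4⟩ := h.neighbours hσ
  obtain ⟨⟨h0, h1, h2, h3, h4, h5⟩, h6, h7, h8⟩ := h
  -- The root is recoloured too, since `k` may send it to the new vertex. It has at most one
  -- neighbour outside the diamond, so a colour in `SP₉` is available.
  obtain ⟨P, hP⟩ : ∃ P, ∀ y, σ.sign p y ≠ 0 → y ≠ q → y ≠ r →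
      extSign diamondSign (some P) (k y) = σ.sign p y := by
    rcases exists_third hσ q p r (by rwa [h7]) (by rw [h8]; simpa) n5 with ⟨x, hx, -, -, N⟩ | N
    · obtain ⟨P, hP⟩ := exists_extSign_one (k x) _ hx
      refine ⟨P, fun y hy hyq hyr => ?_⟩
      obtain rfl : y = x := ((N y hy).resolve_left hyq).resolve_left hyr
      exact hP
    · exact ⟨0, fun y hy hyq hyr => ((N y hy).elim hyq hyr).elim⟩
  obtain ⟨Q, e₁, R, e₂, Q₁, e₃, e₄, Q₂, e₅, e₆, e₇⟩ := exists_extSign_diamond P a t h6 h0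
  set c : V → Option (Fin 3 × Fin 3) := fun x => if x = p then some P else if x = q then Q else
    if x = r then R else if x = q₁ then Q₁ else if x = q₂ then Q₂ else k x with hc
  have cp : c p = some P := by simp [hc]
  have cq : c q = Q := by simp [hc, n1.symm]
  have cr : c r = R := by simp [hc, n2.symm, n5.symm]
  have cq₁ : c q₁ = Q₁ := by simp [hc, n3.symm, n6.symm, n8.symm]
  have cq₂ : c q₂ = Q₂ := by simp [hc, n4.symm, n7.symm, n9.symm, n10.symm]
  have co : ∀ x, x ≠ p → x ≠ q → x ≠ r → x ≠ q₁ → x ≠ q₂ → c x = k x := by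
    intro x i1 i2 i3 i4 i5
    simp [hc, i1, i2, i3, i4, i5]
  have comm := extSign_comm diamondSign
  refine ⟨c, IsHom.extend (T := {p, q, r, q₁, q₂}) comm (c := k) ?_ ?_ ?_⟩
  · intro x y hxy
    obtain ⟨hx, hy, hxy⟩ := isolate_sign_ne_zero.1 hxy
    rw [isolate_sign hx hy]
    have hx' : x ∉ ({q, r, q₁, q₂} : Set V) := fun e => hx (.inr e)
    have hy' : y ∉ ({q, r, q₁, q₂} : Set V) := fun e => hy (.inr e)
    rw [hk x y (isolate_sign_ne_zero.2 ⟨hx', hy', hxy⟩), isolate_sign hx' hy']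
  · intro x hx
    simp only [Set.mem_insert_iff, Set.mem_singleton_iff, not_or] at hx
    exact co x hx.1 hx.2.1 hx.2.2.1 hx.2.2.2.1 hx.2.2.2.2
  · rintro x (rfl | rfl | rfl | rfl | rfl) y hy
    · by_cases hyq : y = q
      · rw [hyq, cp, cq, e₁, h7]
      by_cases hyr : y = r
      · rw [hyr, cp, cr, e₂, h8]
      have hyq₁ : y ≠ q₁ := by
        rintro rfl
        rcases N3 x (by rwa [σ.symm]) with e | e | e
        exacts [n1 e, n2 e, n4 e]
      have hyq₂ : y ≠ q₂ := by
        rintro rfl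
        rcases N4 x (by rwa [σ.symm]) with e | e | e
        exacts [n1 e, n2 e, n3 e]
      rw [cp, co y (ne_of_sign hy).symm hyq hyr hyq₁ hyq₂, hP y hy hyq hyr]
    · rcases N1 y hy with rfl | rfl | rfl
      · rw [cp, cq, comm, e₁, σ.symm, h7]
      · rw [cq, cq₁, e₃, h1]
      · rw [cq, cq₂, e₅, h2]
    · rcases N2 y hy with rfl | rfl | rfl
      · rw [cp, cr, comm, e₂, σ.symm, h8]
      · rw [cr, cq₁, e₄, h3]
      · rw [cr, cq₂, e₆, h4]
    · rcases N3 y hy with rfl | rfl | rfl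
      · rw [cq, cq₁, comm, e₃, σ.symm, h1]
      · rw [cr, cq₁, comm, e₄, σ.symm, h3]
      · rw [cq₁, cq₂, e₇, h5]
    · rcases N4 y hy with rfl | rfl | rfl
      · rw [cq, cq₂, comm, e₅, σ.symm, h2]
      · rw [cr, cq₂, comm, e₆, σ.symm, h4]
      · rw [cq₁, cq₂, comm, e₇, σ.symm, h5]

theorem IsHom.some {c : V → Fin 3 × Fin 3} (hc : σ.IsHom sp9Sign c)
    (f : Fin 3 × Fin 3 → SignType) : σ.IsHom (extSign f) fun x => some (c x) :=
  hc

theorem Subcubic.exists_isHom_of_degenerate [Finite V] (hσ : σ.Subcubic) (hd : σ.Degenerate) :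
    ∃ k : V → Option (Fin 3 × Fin 3), σ.IsHom (extSign diamondSign) k := by
  induction hn : σ.support.ncard using Nat.strong_induction_on generalizing σ with
  | _ n ih =>
  subst hn
  by_cases h : σ.DiamondFree
  · obtain ⟨c, hc⟩ := (⟨hσ, hd, h⟩ : σ.Good).exists_isHom
    exact ⟨_, hc.some _⟩
  · simp only [DiamondFree, not_forall, not_not] at h
    obtain ⟨p, q, r, q₁, q₂, a, t, h⟩ := h
    have hsub := isolate_isSubgraph σ {q, r, q₁, q₂}
    obtain ⟨k, hk⟩ := ih _ (ncard_support_isolate_lt (v := q)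
      ⟨q₁, by rw [h.left_fst]; exact h.ne_zero⟩ (by simp)) (hsub.subcubic hσ)
      (hsub.degenerate hd) rfl
    exact h.exists_isHom hσ hk

/-- The only nonempty set of vertices closed under adjacency is the set of all vertices. -/
def IsConnected (σ : SignGraph V) : Prop :=
  ∀ S : Set V, S.Nonempty → (∀ x ∈ S, ∀ y, σ.sign x y ≠ 0 → y ∈ S) → S = Set.univ

/-- A set violating degeneracy contains all `σ`-neighbours of its members, so it is everything,
including `v`. -/
theorem IsConnected.degenerate (hconn : σ.IsConnected) (hσ : σ.Subcubic) {σ' : SignGraph V}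
    (h : σ'.IsSubgraph σ) {v : V} (hv : σ'.TwoNeighboursIn Set.univ v) : σ'.Degenerate := by
  intro S hS
  by_contra! hS'
  obtain rfl := hconn S hS fun x hx y hy =>
    hσ.mem_of_not_twoNeighboursIn (fun h' => hS' x hx (h.twoNeighboursIn h')) hy
  exact hS' v trivial hv

/-- The neighbours of `v` are `a`, `b`, `c`, and the edge to `a` is the one of a different sign. -/
structure Split (σ : SignGraph V) (v a b c : V) : Prop where
  ne_ab : a ≠ b
  ne_ac : a ≠ c
  ne_bc : b ≠ c
  sign_ne_zero : ∀ y, σ.sign v y ≠ 0 ↔ y = a ∨ y = b ∨ y = c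
  sign_fst : σ.sign v a = -σ.sign v b
  sign_snd : σ.sign v b = σ.sign v c

theorem Split.swap {v a b c : V} (h : σ.Split v a b c) : σ.Split v a c b :=
  ⟨h.2, h.1, h.3.symm, fun y => by rw [h.4]; tauto, by rw [h.5, h.6], h.6.symm⟩

/-- The edge `v c` has the majority sign at both ends. Delete it, colour the rest in `SP₉`, then
move `v` to the new vertex. -/
theorem Split.exists_isHom [Finite V] (hσ : σ.Subcubic) (hD : σ.DiamondFree)
    (hconn : σ.IsConnected) {v a b c y z : V} (hv : σ.Split v a b c) (hc : σ.Split c y z v) :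
    ∃ (f : Fin 3 × Fin 3 → SignType) (k : V → Option (Fin 3 × Fin 3)),
      σ.IsHom (extSign f) k := by
  classical
  have va : σ.sign v a ≠ 0 := (hv.4 a).2 (.inl rfl)
  have vb : σ.sign v b ≠ 0 := (hv.4 b).2 (.inr (.inl rfl))
  have vc : σ.sign v c ≠ 0 := (hv.4 c).2 (.inr (.inr rfl))
  have cy : σ.sign c y ≠ 0 := (hc.4 y).2 (.inl rfl)
  have cz : σ.sign c z ≠ 0 := (hc.4 z).2 (.inr (.inl rfl))
  have nvc := ne_of_sign vc
  have hsub := σ.setSign_zero_isSubgraph nvc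
  have eq_of : ∀ {x x'}, ¬((x = v ∧ x' = c) ∨ (x = c ∧ x' = v)) →
      (σ.setSign v c 0 nvc).sign x x' = σ.sign x x' := setSign_sign_of_ne
  obtain ⟨g, hg⟩ := (⟨hsub.subcubic hσ, hconn.degenerate hσ hsub (v := v) ⟨a, b, fun x _ hx => by
      rcases (hv.4 x).1 (hsub.ne_zero hx) with e | e | rfl
      exacts [.inl e, .inr e, absurd setSign_sign hx]⟩,
    hsub.diamondFree hD⟩ : (σ.setSign v c 0 nvc).Good).exists_isHom
  have hg' : ∀ x x', ¬((x = v ∧ x' = c) ∨ (x = c ∧ x' = v)) → σ.sign x x' ≠ 0 →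
      sp9Sign (g x) (g x') = σ.sign x x' := fun x x' h h' => by
    rw [hg x x' (by rwa [eq_of h]), eq_of h]
  have ga := hg' v a (by have := hv.ne_ac; tauto) va
  have gb := hg' v b (by have := hv.ne_bc; tauto) vb
  have gy := hg' c y (by have := hc.ne_ac; tauto) cy
  have gz := hg' c z (by have := hc.ne_bc; tauto) cz
  have gab : g b ≠ g a := fun e => signType_ne_neg vb (by rw [← hv.sign_fst, ← ga, ← gb, e])
  -- The new vertex gets the minority sign of `v` only at `g a`, so `c` has to avoid that colour. It
  -- can, because its edges to `y` and `z` have different signs.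
  obtain ⟨Z, Zy, Zz, Za⟩ := sp9_exists_two_ne (g y) (g z) (g a) _ _ cy cz
    (fun e => by rw [← gy, ← gz, e])
    (fun e => signType_ne_neg cz (by rw [← hc.sign_fst, e.1]))
  set k : V → Option (Fin 3 × Fin 3) :=
    fun x => if x = v then none else if x = c then some Z else some (g x) with hk
  have kv : k v = none := by simp [hk]
  have kc : k c = some Z := by simp [hk, nvc.symm]
  have ko : ∀ x, x ≠ v → x ≠ c → k x = some (g x) := by
    intro x h1 h2
    simp [hk, h1, h2]
  refine ⟨fun X => if X = g a then σ.sign v a else σ.sign v b, k,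
    IsHom.extend (T := {v, c}) (extSign_comm _) (c := fun x => some (g x)) ?_ ?_ ?_⟩
  · intro x x' hx
    obtain ⟨h1, h2, h3⟩ := isolate_sign_ne_zero.1 hx
    rw [isolate_sign h1 h2]
    refine hg' x x' ?_ h3
    rintro (⟨e, -⟩ | ⟨e, -⟩)
    exacts [h1 (.inl e), h1 (.inr e)]
  · intro x hx
    exact ko x (fun e => hx (.inl e)) fun e => hx (.inr e)
  · rintro x (rfl | rfl) x' hx'
    · rcases (hv.4 x').1 hx' with rfl | rfl | rfl
      · rw [kv, ko x' (ne_of_sign va).symm hv.ne_ac]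
        simp [extSign]
      · rw [kv, ko x' (ne_of_sign vb).symm hv.ne_bc]
        simp [extSign, gab]
      · rw [kv, kc]
        simp [extSign, Za, hv.sign_snd]
    · rcases (hc.4 x').1 hx' with rfl | rfl | rfl
      · rw [kc, ko x' hc.ne_ac (ne_of_sign cy).symm]
        exact Zy
      · rw [kc, ko x' hc.ne_bc (ne_of_sign cz).symm]
        exact Zz
      · rw [kv, kc]
        simp [extSign, Za, hv.sign_snd, σ.symm]

/-- Connected cubic signed graphs map to an extension of `SP₉` by one vertex. -/
theorem IsConnected.exists_isHom [Finite V] [Nonempty V] (hconn : σ.IsConnected)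
    (hσ : ∀ v, ∃ a b c, a ≠ b ∧ a ≠ c ∧ b ≠ c ∧ ∀ y, σ.sign v y ≠ 0 ↔ y = a ∨ y = b ∨ y = c) :
    ∃ (f : Fin 3 × Fin 3 → SignType) (k : V → Option (Fin 3 × Fin 3)),
      σ.IsHom (extSign f) k := by
  classical
  have hsub : σ.Subcubic := fun x => by
    obtain ⟨a, b, c, -, -, -, h⟩ := hσ x
    exact ⟨a, b, c, fun y => (h y).1⟩
  by_cases hD : σ.DiamondFree
  swap
  · simp only [DiamondFree, not_forall, not_not] at hD
    obtain ⟨p, q, r, q₁, q₂, a, t, h⟩ := hD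
    have hi := isolate_isSubgraph σ {q, r, q₁, q₂}
    obtain ⟨k, hk⟩ := (hi.subcubic hsub).exists_isHom_of_degenerate
      (hconn.degenerate hsub hi (v := q) ⟨q, q, fun y _ hy =>
        absurd (isolate_sign_left (by simp)) hy⟩)
    exact ⟨_, h.exists_isHom hsub hk⟩
  by_cases hmono : ∃ v s, ∀ y, σ.sign v y ≠ 0 → σ.sign v y = s
  -- The vertex `v` becomes the new vertex, joined to all of `SP₉` with sign `s`.
  · obtain ⟨v, s, hs⟩ := hmono
    have hi := isolate_isSubgraph σ {v}
    obtain ⟨c, hc⟩ := (⟨hi.subcubic hsub, hconn.degenerate hsub hi (v := v) ⟨v, v, fun y _ hy =>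
        absurd (isolate_sign_left (by simp)) hy⟩, hi.diamondFree hD⟩ :
      (σ.isolate {v}).Good).exists_isHom
    exact ⟨fun _ => s, _, (hc.some _).extend_one (extSign_comm _) (z := none)
      fun y hy => (hs y hy).symm⟩
  have hsplit : ∀ v, ∃ a b c, σ.Split v a b c := by
    intro v
    obtain ⟨a, b, c, hab, hac, hbc, h⟩ := hσ v
    have va : σ.sign v a ≠ 0 := (h a).2 (.inl rfl)
    have vb : σ.sign v b ≠ 0 := (h b).2 (.inr (.inl rfl))
    have vc : σ.sign v c ≠ 0 := (h c).2 (.inr (.inr rfl))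
    rcases signType_eq_or_eq_neg va vb with eb | eb <;>
      rcases signType_eq_or_eq_neg va vc with ec | ec
    · refine absurd ⟨v, σ.sign v a, fun y hy => ?_⟩ hmono
      rcases (h y).1 hy with rfl | rfl | rfl
      exacts [rfl, eb, ec]
    · exact ⟨c, a, b, hac.symm, hbc.symm, hab, fun y => by rw [h]; tauto, ec, eb.symm⟩
    · exact ⟨b, a, c, hab.symm, hbc, hac, fun y => by rw [h]; tauto, eb, ec.symm⟩
    · exact ⟨a, b, c, hab, hac, hbc, h, by rw [eb, neg_neg], by rw [eb, ec]⟩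
  choose m b c hm using hsplit
  by_contra hcon
  -- With `m` the minority neighbour: an edge in the majority at `v` must be the minority edge at
  -- its other end. Hence both majority neighbours of `v` are sent to `v`, so `m` is surjective but
  -- not injective.
  have key : ∀ {v α β x}, σ.Split v α β x → m x = v := by
    intro v α β x h
    have hv : σ.sign x v ≠ 0 := by
      rw [σ.symm]; exact (h.4 x).2 (.inr (.inr rfl))
    rcases ((hm x).4 v).1 hv with e | e | e
    · exact e.symm
    · subst e
      exact (hcon (Split.exists_isHom hsub hD hconn h (hm x).swap)).elim
    · subst e
      exact (hcon (Split.exists_isHom hsub hD hconn h (hm x))).elim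
  have hsurj : Function.Surjective m := fun v => ⟨c v, key (hm v)⟩
  obtain ⟨v⟩ := ‹Nonempty V›
  exact (hm v).ne_bc (Finite.injective_iff_surjective.2 hsurj
    ((key (hm v).swap).trans (key (hm v)).symm))

end SignGraph

/-! ### Translation back to 2-edge coloured graphs -/

namespace TwoEdgeColouredGraph

variable {V W : Type*}

theorem edgeSign_comm (G : TwoEdgeColouredGraph V) {x y : V} (h : G.graph.Adj x y) :
    G.edgeSign h.symm = G.edgeSign h := by
  simp only [edgeSign, Sym2.eq_swap]

open scoped Classical in
/-- The sign matrix of a 2-edge coloured graph. -/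
noncomputable def toSignGraph (G : TwoEdgeColouredGraph V) : SignGraph V where
  sign x y := if h : G.graph.Adj x y then (if G.edgeSign h = EdgeSign.pos then 1 else -1) else 0
  symm x y := by
    by_cases h : G.graph.Adj x y
    · simp only [dif_pos h, dif_pos h.symm, G.edgeSign_comm h]
    · have h' : ¬ G.graph.Adj y x := fun e => h e.symm
      simp only [dif_neg h, dif_neg h']
  irrefl x := by simp

theorem toSignGraph_sign_ne_zero (G : TwoEdgeColouredGraph V) {x y : V} :
    G.toSignGraph.sign x y ≠ 0 ↔ G.graph.Adj x y := by
  by_cases h : G.graph.Adj x y <;> simp only [toSignGraph, h, dite_true, dite_false]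
  · split_ifs <;> decide
  · decide

theorem toSignGraph_sign_eq_one (G : TwoEdgeColouredGraph V) {x y : V} (h : G.graph.Adj x y) :
    G.toSignGraph.sign x y = 1 ↔ G.edgeSign h = EdgeSign.pos := by
  simp only [toSignGraph, h, dite_true]
  split_ifs with h' <;> simp [h']

open scoped Classical in
/-- The extension of `SP₉` by a vertex that is joined to `z` with sign `f z`. -/
noncomputable def extGraph (f : Fin 3 × Fin 3 → SignType) :
    TwoEdgeColouredGraph (Option (Fin 3 × Fin 3)) where
  graph :=
    { Adj x y := extSign f x y ≠ 0
      symm := ⟨fun x y h => by rwa [extSign_comm]⟩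
      loopless := ⟨fun x h => h (extSign_self f x)⟩ }
  sign e := if e.1 ∈ Sym2.fromRel (r := fun x y => extSign f x y = 1)
      ⟨fun x y h => by rwa [extSign_comm]⟩ then EdgeSign.pos else EdgeSign.neg

theorem extGraph_edgeSign (f : Fin 3 × Fin 3 → SignType) {x y : Option (Fin 3 × Fin 3)}
    (h : (extGraph f).graph.Adj x y) :
    (extGraph f).edgeSign h = EdgeSign.pos ↔ extSign f x y = 1 := by
  simp [edgeSign, extGraph]

theorem edgeSign_eq_of_iff {a b : EdgeSign} (h : a = EdgeSign.pos ↔ b = EdgeSign.pos) : a = b := by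
  cases a <;> cases b <;> simp_all

theorem SP9_edgeSign {x y : Fin 3 × Fin 3} (h : SP9.graph.Adj x y) :
    SP9.edgeSign h = EdgeSign.pos ↔ sp9Sign x y = 1 := by
  have hne : x ≠ y := h
  have : SP9.edgeSign h = EdgeSign.pos ↔
      ((⊤ : SimpleGraph (Fin 3)).boxProd (⊤ : SimpleGraph (Fin 3))).Adj x y := by
    have h' : ¬(x.1 = y.1 ∧ x.2 = y.2) := fun e => hne (Prod.ext e.1 e.2)
    simp [edgeSign, SP9]
    tauto
  rw [this, SimpleGraph.boxProd_adj]
  simp only [SimpleGraph.top_adj]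
  clear this h
  revert x y
  decide +kernel

theorem isOneVertexExtension_extGraph (f : Fin 3 × Fin 3 → SignType) :
    SP9.IsOneVertexExtension (extGraph f) := by
  refine ⟨fun x y => ?_, fun x y h h' => edgeSign_eq_of_iff ?_⟩
  · exact (not_congr sp9Sign_eq_zero).trans Iff.rfl
  · rw [extGraph_edgeSign, SP9_edgeSign]
    rfl

/-- A map that preserves sign matrices is a homomorphism. -/
def homExtGraph (G : TwoEdgeColouredGraph V) {f : Fin 3 × Fin 3 → SignType}
    {k : V → Option (Fin 3 × Fin 3)} (hk : G.toSignGraph.IsHom (extSign f) k) :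
    G.Hom (extGraph f) where
  toHom :=
    { toFun := k
      map_rel' := fun {x y} h => by
        have h' := G.toSignGraph_sign_ne_zero.2 h
        change extSign f (k x) (k y) ≠ 0
        rwa [hk x y h'] }
  map_edgeSign x y h := by
    refine edgeSign_eq_of_iff ?_
    rw [extGraph_edgeSign, ← G.toSignGraph_sign_eq_one h,
      ← hk x y (G.toSignGraph_sign_ne_zero.2 h)]
    rfl

theorem Hom.colourable {G : TwoEdgeColouredGraph V} {H : TwoEdgeColouredGraph W} (φ : G.Hom H)
    {n : ℕ} (e : W ≃ Fin n) : G.Colourable n := by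
  refine ⟨⟨H.graph.comap e.symm,
    fun x => H.sign ((SimpleGraph.Hom.comap e.symm H.graph).mapEdgeSet x)⟩,
    ⟨⟨⟨fun x => e (φ.toHom x), fun {x y} h => ?_⟩, fun x y h => ?_⟩⟩⟩
  · simpa using φ.toHom.map_adj h
  · rw [φ.map_edgeSign x y h]
    simp only [edgeSign]
    congr 1
    apply Subtype.ext
    simp

theorem toSignGraph_isConnected (G : TwoEdgeColouredGraph V) (h : G.graph.Connected) :
    G.toSignGraph.IsConnected := by
  rintro S ⟨x, hx⟩ hS
  refine Set.eq_univ_of_forall fun y => ?_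
  obtain ⟨w⟩ := h.preconnected x y
  induction w with
  | nil => exact hx
  | cons hadj _ ih => exact ih (hS _ hx _ (G.toSignGraph_sign_ne_zero.2 hadj))

end TwoEdgeColouredGraph

theorem mainTheorem1 {V : Type*} [Fintype V] (G : TwoEdgeColouredGraph V)
    [DecidableRel G.graph.Adj] (hcubic : G.graph.IsRegularOfDegree 3)
    (hconn : G.graph.Connected) :
    G.chromaticNumber ≤ 10 ∧
      ∃ H : TwoEdgeColouredGraph (Option (Fin 3 × Fin 3)),
        TwoEdgeColouredGraph.SP9.IsOneVertexExtension H ∧ Nonempty (G.Hom H) := by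
  classical
  have : Nonempty V := hconn.nonempty
  obtain ⟨f, k, hk⟩ := (G.toSignGraph_isConnected hconn).exists_isHom fun v => by
    obtain ⟨a, b, c, hab, hac, hbc, h⟩ := Finset.card_eq_three.1 (hcubic v)
    refine ⟨a, b, c, hab, hac, hbc, fun y => ?_⟩
    rw [G.toSignGraph_sign_ne_zero, ← SimpleGraph.mem_neighborFinset, h]
    simp
  refine ⟨?_, _, TwoEdgeColouredGraph.isOneVertexExtension_extGraph f, ⟨G.homExtGraph hk⟩⟩
  exact iInf₂_le (10 : ℕ) ((G.homExtGraph hk).colourable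
    (Fintype.equivFinOfCardEq (by simp)))
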